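/- The base field is $\mathbb C$. A \emph{classical} Lie algebra of type $X\in\{A,C,O\}$ with natural module $V=\mathbb C^n$ is $\mathfrak{sl}(n)$, $\mathfrak{sp}(n)$ ($n$ even), $\mathfrak{so}(n)$, respectively. An inclusion $\mathfrak g_1\subset\mathfrak g_2$ of classical simple Lie algebras with natural modules $V_1,V_2$ is \emph{diagonal of signature} $(l,r,z)$ if $V_2|_{\mathfrak g_1}\cong V_1^{\oplus l}\oplus (V_1^*)^{\oplus r}\oplus T^{\oplus z}$, where $T$ is the one-dimensional trivial module. Let $\mathcal T=\{(l_i,r_i,z_i)\}_{i\ge1}$ be a sequence of triples of non-negative integers with $r_1=z_1=0$, $l_i>0$ and $l_i\ge r_i$ for all $i$, and $r_i=0$ for all $i$ if $X\ne A$. Put $s_i=l_i+r_i$, $n_1=1$, $n_{i+1}=s_in_i+z_i$. An infinite-dimensional Lie algebra $\mathfrak s$ is a \emph{diagonal Lie algebra} $X(\mathcal T)$ if it is the union of a chain $\mathfrak s_2\subset\mathfrak s_3\subset\cdots$ of simple classical Lie subalgebras of type $X$ such that the natural module of $\mathfrak s_i$ has dimension $n_i$ and $\mathfrak s_i\subset\mathfrak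 s_{i+1}$ is diagonal of signature $(l_i,r_i,z_i)$ for all $i\ge2$. (Here an identification of each $\mathfrak s_i$ with the classical Lie algebra, and thus its natural module, is fixed once and for all.) A \emph{Steinitz number} is a formal product $\prod_p p^{\alpha_p}$ over all primes, with $\alpha_p\in\{0,1,2,\dots\}\cup\{\infty\}$; Steinitz numbers are multiplied by adding exponents, and $\Pi$ divides $\Pi'$ if each exponent of $\Pi$ is at most the corresponding exponent of $\Pi'$. For the sequence $\mathcal S=(s_i)_{i\ge1}$, $\mathrm{Stz}(\mathcal S)$ is the infinite product $\prod_{i\ge1}s_i$ regarded as a Steinitz number. A Lie algebra is \emph{finitary} here if it is isomorphic to $\mathfrak{sl}(\infty)$, $\mathfrak{so}(\infty)$ or $\mathfrak{sp}(\infty)$, the Lie algebras of $\mathbb N\times\mathbb N$ complex matrices with finitely many non-zero entries that have trace zero, are skew-symmetric, or are skew with respect to the standard non-degenerate alternating form, respectively. \textbf{Proposition.} Let $\mathfrak s_1=X_1(\mathcal T_1)$ and $\mathfrak s_2=X_2(\mathcal T_2)$ be infinite-dimensional diagonal Lie algebras ($X_1,X_2\in\{A,C,O\}$), and let $\mathcal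 S_1,\mathcal S_2$ be the corresponding sequences of the numbers $l_i+r_i$. If $\mathfrak s_1$ is isomorphic to a subalgebra of $\mathfrak s_2$ (that is, there is an injective homomorphism $\mathfrak s_1\to\mathfrak s_2$), then $\mathrm{Stz}(\mathcal S_1)$ divides $N\cdot\mathrm{Stz}(\mathcal S_2)$ for some positive integer $N$. In particular, if $\mathfrak s_1$ is not finitary and $\mathfrak s_2$ is finitary, then there is no injective homomorphism $\mathfrak s_1\to\mathfrak s_2$. -/

import Mathlib

namespace DiagonalLie

/-! An associative ring is a Lie ring under the commutator. -/
attribute [local instance 100] LieRing.ofAssociativeRing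

/-! ### Steinitz numbers -/

/-- A Steinitz number `∏ p ^ α_p` is a map from the primes to `{0, 1, 2, …} ∪ {∞}`. -/
abbrev SteinitzNumber : Type := Nat.Primes → ℕ∞

namespace SteinitzNumber

/-- The product of Steinitz numbers: exponents are added. -/
def mul (a b : SteinitzNumber) : SteinitzNumber := fun p => a p + b p

/-- Divisibility of Steinitz numbers: exponents are compared prime by prime. -/
def Divides (a b : SteinitzNumber) : Prop := ∀ p, a p ≤ b p

/-- A positive integer as a Steinitz number. -/
def ofPosNat (n : ℕ) : SteinitzNumber := fun p => (padicValNat p n : ℕ∞)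

end SteinitzNumber

/-- `Stz(s)`: the infinite product `∏ i, s i` of positive integers as a Steinitz number. The
exponent of `p` is the supremum of the exponents of `p` in the finite partial products. -/
noncomputable def Stz (s : ℕ → ℕ) : SteinitzNumber :=
  fun p => ⨆ k : ℕ, SteinitzNumber.ofPosNat (∏ i ∈ Finset.range k, s i) p

/-! ### Finite-dimensional classical Lie algebras with their natural modules -/

/-- The three types of classical Lie algebras; `O` stands for both `B` and `D`. -/
inductive ClassicalType : Type
  | A
  | C
  | O

/-- The matrix of the standard alternating form, with `⟨e_{2k}, e_{2k+1}⟩ = 1`. -/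
def altEntry (i j : ℕ) : ℂ :=
  if Even i ∧ j = i + 1 then 1 else if Even j ∧ i = j + 1 then -1 else 0

/-- The classical Lie algebra of type `X` with natural module `ℂ ^ n` (column vectors):
`sl(n)` for `A`, `so(n)` for `O`, and `sp(n)` for `C` (there meaningful for even `n`). -/
noncomputable def classical (X : ClassicalType) (n : ℕ) :
    LieSubalgebra ℂ (Matrix (Fin n) (Fin n) ℂ) :=
  match X with
  | .A => LieAlgebra.SpecialLinear.sl (Fin n) ℂ
  | .C => skewAdjointMatricesLieSubalgebra (Matrix.of fun i j : Fin n => altEntry i j)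
  | .O => LieAlgebra.Orthogonal.so (Fin n) ℂ

/-- A triple `(l, r, z)` of non-negative integers. -/
structure Triple : Type where
  l : ℕ
  r : ℕ
  z : ℕ

/-- The homomorphism `φ` of matrix Lie algebras is diagonal of signature `(l, r, z)`: the natural
module of the target, restricted along `φ`, is isomorphic to `V^l ⊕ (V^*)^r ⊕ T^z`, where `V` is
the natural module of the source, `V^*` its dual (in dual coordinates `x` acts by `-xᵀ`), and `T`
is the trivial one-dimensional module. -/
def HasSignature {n m : ℕ} {G : LieSubalgebra ℂ (Matrix (Fin n) (Fin n) ℂ)}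
    {H : LieSubalgebra ℂ (Matrix (Fin m) (Fin m) ℂ)} (φ : G →ₗ⁅ℂ⁆ H) (t : Triple) : Prop :=
  ∃ e : (Fin m → ℂ) ≃ₗ[ℂ]
      (Fin t.l → Fin n → ℂ) × (Fin t.r → Fin n → ℂ) × (Fin t.z → ℂ),
    ∀ (x : G) (v : Fin m → ℂ),
      e ((φ x : Matrix (Fin m) (Fin m) ℂ).mulVec v) =
        (fun a => (x : Matrix (Fin n) (Fin n) ℂ).mulVec ((e v).1 a),
         fun a => -((x : Matrix (Fin n) (Fin n) ℂ).transpose.mulVec ((e v).2.1 a)),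
         0)

/-! ### Diagonal Lie algebras `X(T)` -/

/-- The sequence `s_i = l_i + r_i`. -/
def sSeq (T : ℕ → Triple) (i : ℕ) : ℕ := (T i).l + (T i).r

/-- The dimensions of the natural modules: `1` at index `0`, then `(l_i + r_i) n_i + z_i`. -/
def natDim (T : ℕ → Triple) : ℕ → ℕ
  | 0 => 1
  | i + 1 => sSeq T i * natDim T i + (T i).z

/-- The conventions on a sequence of triples for type `X`. Indices start at `0`; the triple of
index `0` is `(n, 0, 0)` with `n` the dimension of the first natural module. -/
structure IsTripleSeq (X : ClassicalType) (T : ℕ → Triple) : Prop where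
  r_zero : (T 0).r = 0
  z_zero : (T 0).z = 0
  l_pos : ∀ i, 0 < (T i).l
  r_le_l : ∀ i, (T i).r ≤ (T i).l
  r_eq_zero : X ≠ ClassicalType.A → ∀ i, (T i).r = 0

/-- An exhaustion of the complex Lie algebra `L` by simple classical subalgebras of type `X` whose
inclusions are diagonal with signatures given by `T`. The formal first term of index `0` (with
one-dimensional natural module) is omitted: `sub i` has natural module of dimension
`natDim T (i + 1)`, and `sub i ⊂ sub (i + 1)` has signature `T (i + 1)`. -/
structure DiagonalExhaustion (X : ClassicalType) (T : ℕ → Triple)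
    (L : Type*) [LieRing L] [LieAlgebra ℂ L] where
  sub : ℕ → LieSubalgebra ℂ L
  le_succ : ∀ i, sub i ≤ sub (i + 1)
  exhausts : ∀ x : L, ∃ i, x ∈ sub i
  simple : ∀ i, LieAlgebra.IsSimple ℂ (sub i)
  even_dim : X = ClassicalType.C → ∀ i, Even (natDim T (i + 1))
  equiv : ∀ i, sub i ≃ₗ⁅ℂ⁆ classical X (natDim T (i + 1))
  signature : ∀ i, HasSignature
    (((equiv (i + 1)).toLieHom.comp (LieSubalgebra.inclusion (le_succ i))).comp
      (equiv i).symm.toLieHom) (T (i + 1))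

/-- `L` is (isomorphic to) the infinite-dimensional diagonal Lie algebra `X(T)`. -/
structure IsDiagonalLieAlgebra (X : ClassicalType) (T : ℕ → Triple)
    (L : Type*) [LieRing L] [LieAlgebra ℂ L] : Prop where
  tripleSeq : IsTripleSeq X T
  exhaustion : Nonempty (DiagonalExhaustion X T L)
  infinite_dim : ¬ FiniteDimensional ℂ L

/-! ### The finitary Lie algebras `sl(∞)`, `so(∞)`, `sp(∞)` -/

/-- The space with basis `e_0, e_1, e_2, …`. -/
abbrev V : Type := ℕ →₀ ℂ

/-- The matrix entry `(i, j)` of an operator on `V`. -/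
noncomputable def entry (f : Module.End ℂ V) (i j : ℕ) : ℂ := f (Finsupp.single j 1) i

/-- The matrix of `f` vanishes outside the upper left `n × n` block. -/
def SupportedIn (f : Module.End ℂ V) (n : ℕ) : Prop :=
  ∀ i j, n ≤ i ∨ n ≤ j → entry f i j = 0

theorem SupportedIn.mono {f : Module.End ℂ V} {n m : ℕ} (h : SupportedIn f n) (hnm : n ≤ m) :
    SupportedIn f m := fun i j hij => h i j (hij.imp hnm.trans hnm.trans)

theorem entry_mul (f g : Module.End ℂ V) {n : ℕ} (hg : SupportedIn g n) (i j : ℕ) :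
    entry (f * g) i j = ∑ k ∈ Finset.range n, entry f i k * entry g k j := by
  have h : g (Finsupp.single j 1) =
      ∑ k ∈ Finset.range n, Finsupp.single k (entry g k j) := by
    ext a
    rw [Finsupp.finsetSum_apply]
    simp only [Finsupp.single_apply]
    rw [Finset.sum_ite_eq']
    split_ifs with ha
    · rfl
    · exact hg a j (Or.inl (by simpa using ha))
  change f (g (Finsupp.single j 1)) i = _
  rw [h, map_sum, Finsupp.finsetSum_apply]
  refine Finset.sum_congr rfl fun k _ => ?_
  have : Finsupp.single k (entry g k j) = entry g k j • Finsupp.single k (1 : ℂ) := by simp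
  rw [this, map_smul]
  exact mul_comm _ _

theorem SupportedIn.mul {f g : Module.End ℂ V} {n : ℕ} (hf : SupportedIn f n)
    (hg : SupportedIn g n) : SupportedIn (f * g) n := by
  intro i j hij
  rw [entry_mul f g hg]
  refine Finset.sum_eq_zero fun k _ => ?_
  rcases hij with h | h
  · rw [hf i k (Or.inl h), zero_mul]
  · rw [hg k j (Or.inr h), mul_zero]

theorem entry_sub (f g : Module.End ℂ V) (i j : ℕ) :
    entry (f - g) i j = entry f i j - entry g i j := by simp [entry]

theorem entry_add (f g : Module.End ℂ V) (i j : ℕ) :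
    entry (f + g) i j = entry f i j + entry g i j := by simp [entry]

/-- `gl(∞)`: operators whose matrix has only finitely many non-zero entries. -/
def glInf : LieSubalgebra ℂ (Module.End ℂ V) where
  carrier := {f | ∃ n, SupportedIn f n}
  zero_mem' := ⟨0, fun i j _ => by simp [entry]⟩
  add_mem' := by
    rintro f g ⟨n, hn⟩ ⟨m, hm⟩
    refine ⟨max n m, fun i j hij => ?_⟩
    rw [entry_add, hn.mono (le_max_left n m) i j hij, hm.mono (le_max_right n m) i j hij, add_zero]
  smul_mem' := by
    rintro c f ⟨n, hn⟩
    refine ⟨n, fun i j hij => ?_⟩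
    have : entry (c • f) i j = c * entry f i j := by simp [entry]
    rw [this, hn i j hij, mul_zero]
  lie_mem' := by
    rintro f g ⟨n, hn⟩ ⟨m, hm⟩
    have hn' := hn.mono (le_max_left n m)
    have hm' := hm.mono (le_max_right n m)
    refine ⟨max n m, fun i j hij => ?_⟩
    rw [Ring.lie_def, entry_sub, hn'.mul hm' i j hij, hm'.mul hn' i j hij, sub_zero]

/-- The trace of an operator in `gl(∞)`: the (finite) sum of the diagonal matrix entries. -/
noncomputable def trInf (f : Module.End ℂ V) : ℂ := ∑ᶠ i, entry f i i

theorem trInf_eq {f : Module.End ℂ V} {n : ℕ} (hf : SupportedIn f n) :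
    trInf f = ∑ i ∈ Finset.range n, entry f i i := by
  refine finsum_eq_sum_of_support_subset _ fun i hi => ?_
  by_contra h
  exact hi (hf i i (Or.inl (by simpa using h)))

/-- `sl(∞)`: the operators in `gl(∞)` of trace zero. -/
noncomputable def slInf : LieSubalgebra ℂ (Module.End ℂ V) where
  carrier := {f | f ∈ glInf ∧ trInf f = 0}
  zero_mem' := ⟨glInf.zero_mem, by simp [trInf, entry]⟩
  add_mem' := by
    rintro f g ⟨hf, hf0⟩ ⟨hg, hg0⟩
    refine ⟨glInf.add_mem hf hg, ?_⟩
    obtain ⟨n, hn⟩ := hf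
    obtain ⟨m, hm⟩ := hg
    have hn' := hn.mono (le_max_left n m)
    have hm' := hm.mono (le_max_right n m)
    have hs : SupportedIn (f + g) (max n m) := fun i j hij => by
      rw [entry_add, hn' i j hij, hm' i j hij, add_zero]
    rw [trInf_eq hn'] at hf0
    rw [trInf_eq hm'] at hg0
    rw [trInf_eq hs]
    simp only [entry_add, Finset.sum_add_distrib, hf0, hg0, add_zero]
  smul_mem' := by
    rintro c f ⟨hf, hf0⟩
    refine ⟨glInf.smul_mem c hf, ?_⟩
    have : ∀ i, entry (c • f) i i = c • entry f i i := fun i => by simp [entry]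
    unfold trInf at *
    simp only [this]
    rw [← smul_finsum, hf0, smul_zero]
  lie_mem' := by
    rintro f g ⟨hf, -⟩ ⟨hg, -⟩
    refine ⟨glInf.lie_mem hf hg, ?_⟩
    obtain ⟨n, hn⟩ := hf
    obtain ⟨m, hm⟩ := hg
    have hn' := hn.mono (le_max_left n m)
    have hm' := hm.mono (le_max_right n m)
    have hs : SupportedIn (f * g - g * f) (max n m) := fun i j hij => by
      rw [entry_sub, hn'.mul hm' i j hij, hm'.mul hn' i j hij, sub_zero]
    change trInf (f * g - g * f) = 0
    rw [trInf_eq hs]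
    simp only [entry_sub, Finset.sum_sub_distrib, entry_mul f g hm',
      entry_mul g f hn']
    rw [sub_eq_zero, Finset.sum_comm]
    exact Finset.sum_congr rfl fun i _ => Finset.sum_congr rfl fun j _ => mul_comm _ _

/-- The bilinear form on `V` with `⟨e_i, e_j⟩ = M i j`. -/
noncomputable def bilinOf (M : ℕ → ℕ → ℂ) : LinearMap.BilinForm ℂ V :=
  Finsupp.linearCombination ℂ fun i => Finsupp.linearCombination ℂ fun j => M i j

/-- `so(∞)`: the operators in `gl(∞)` that are skew for the form with `⟨e_i, e_j⟩ = δ_ij`. -/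
noncomputable def soInf : LieSubalgebra ℂ (Module.End ℂ V) :=
  glInf ⊓ skewAdjointLieSubalgebra (bilinOf fun i j => if i = j then 1 else 0)

/-- `sp(∞)`: the operators in `gl(∞)` that are skew for the standard alternating form. -/
noncomputable def spInf : LieSubalgebra ℂ (Module.End ℂ V) :=
  glInf ⊓ skewAdjointLieSubalgebra (bilinOf altEntry)

/-- `L` is finitary: isomorphic to `sl(∞)`, `so(∞)` or `sp(∞)`. -/
def IsFinitary (L : Type*) [LieRing L] [LieAlgebra ℂ L] : Prop :=
  Nonempty (L ≃ₗ⁅ℂ⁆ slInf) ∨ Nonempty (L ≃ₗ⁅ℂ⁆ soInf) ∨ Nonempty (L ≃ₗ⁅ℂ⁆ spInf)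

end DiagonalLie

/-! The argument is a Dynkin-index computation. For a representation, consider the trace form `(x,
y) ↦ tr(φ x φ y)`. Along a diagonal embedding of signature `(l, r, z)` the trace form of the natural
module is multiplied by `l + r`, since a dual summand contributes as much as a natural one and a
trivial summand contributes nothing (`HasSignature.trace_mul`). On a simple algebra all invariant
forms are proportional to a given non-zero one (`exists_smul_eq_of_lieInvariant`), and the trace of
`h²` for an `sl₂`-triple in any finite-dimensional representation is a natural number, non-zero if
`h` acts non-trivially (`exists_nat_trace_mul_self`).

Fix `h` from an `sl₂`-triple in the first term of the exhaustion. Comparing it with a triple of the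
same natural trace in the `i`-th term shows that in every representation of that term the trace of
`h²` is a multiple of the product of the `s` up to `i` (`DiagonalExhaustion.exists_index`). Given an
injective `f`, the trace of `f(h)²` on a natural module of the target is a fixed positive integer
times a product of the `s` of the target, and it is also a multiple of arbitrarily long products of
the `s` of the source. This is the divisibility of Steinitz numbers (`stz_divides_of_injective`).

For a finitary target the same computation is made inside `gl(∞)`, where the trace of `f(h)²` is a
fixed number. Hence the partial products of the source are bounded and `s` is eventually `1`
(`exists_sSeq_eq_one_of_injective`), so all later embeddings have signature `(1, 0, z)`. By linear
algebra with the invariant forms, such an embedding is, up to an isometry, the inclusion as upper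
left block (`HasSignature.exists_isometry`). The isometries can be chosen compatibly, and the union
of the blocks is `sl(∞)`, `so(∞)` or `sp(∞)` (`isFinitary_of_sSeq_eq_one`), so the source is
finitary. -/

namespace DiagonalLie

attribute [local instance 100] LieRing.ofAssociativeRing

/-! ### Traces of squares in representations of `sl₂` -/

section SlTwo

variable {W : Type*} [AddCommGroup W] [Module ℂ W] [FiniteDimensional ℂ W]

theorem isNilpotent_sub_restrict (h : Module.End ℂ W) (μ : ℂ)
    (hm : Set.MapsTo h (h.maxGenEigenspace μ) (h.maxGenEigenspace μ)) :
    IsNilpotent (h.restrict hm - algebraMap ℂ _ μ) := by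
  have := Module.End.isNilpotent_restrict_maxGenEigenspace_sub_algebraMap h μ
  have h2 : h.restrict hm - algebraMap ℂ _ μ = LinearMap.restrict (h - algebraMap ℂ _ μ)
      (Module.End.mapsTo_maxGenEigenspace_of_comm
        (Algebra.mul_sub_algebraMap_commutes h μ) μ) := by
    ext x; rfl
  rw [h2]; exact this

/-- The restriction is `μ` plus a commuting nilpotent, which may be replaced by `μ` under the trace.
This is done twice, once for each factor. -/
theorem trace_restrict_mul_self (h : Module.End ℂ W) (μ : ℂ)
    (hm : Set.MapsTo h (h.maxGenEigenspace μ) (h.maxGenEigenspace μ))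
    (hm' : Set.MapsTo (h * h) (h.maxGenEigenspace μ) (h.maxGenEigenspace μ)) :
    LinearMap.trace ℂ _ ((h * h).restrict hm') =
      μ ^ 2 * (Module.finrank ℂ (h.maxGenEigenspace μ) : ℂ) := by
  set r := h.restrict hm with hr
  have h1 : (h * h).restrict hm' = r ∘ₗ r := by ext; rfl
  have hn := isNilpotent_sub_restrict h μ hm
  rw [h1, LinearMap.trace_comp_eq_mul_of_commute_of_isNilpotent μ (Commute.refl r) hn]
  have h2 : LinearMap.trace ℂ _ r = μ * (Module.finrank ℂ (h.maxGenEigenspace μ) : ℂ) := by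
    have := LinearMap.trace_comp_eq_mul_of_commute_of_isNilpotent (f := 1) (g := r) μ
      (Commute.one_left r) hn
    rwa [Module.End.one_eq_id, LinearMap.id_comp, ← Module.End.one_eq_id, LinearMap.trace_one] at this
  rw [h2]; ring

theorem isInternal_maxGenEigenspace (h : Module.End ℂ W) :
    DirectSum.IsInternal (fun μ : ℂ => h.maxGenEigenspace μ) := by
  classical
  rw [DirectSum.isInternal_submodule_iff_iSupIndep_and_iSup_eq_top]
  exact ⟨h.independent_maxGenEigenspace, h.iSup_maxGenEigenspace_eq_top⟩

theorem trace_mul_self_eq_sum (h : Module.End ℂ W)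
    (hfin : {μ : ℂ | h.maxGenEigenspace μ ≠ ⊥}.Finite) :
    LinearMap.trace ℂ W (h * h) =
      ∑ μ ∈ hfin.toFinset, μ ^ 2 * (Module.finrank ℂ (h.maxGenEigenspace μ) : ℂ) := by
  classical
  have hm : ∀ μ, Set.MapsTo h (h.maxGenEigenspace μ) (h.maxGenEigenspace μ) := fun μ =>
    Module.End.mapsTo_maxGenEigenspace_of_comm (Commute.refl h) μ
  have hm' : ∀ μ, Set.MapsTo (h * h) (h.maxGenEigenspace μ) (h.maxGenEigenspace μ) :=
    fun μ => (hm μ).comp (hm μ)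
  rw [LinearMap.trace_eq_sum_trace_restrict' (isInternal_maxGenEigenspace h) hfin hm']
  exact Finset.sum_congr rfl fun μ _ => trace_restrict_mul_self h μ (hm μ) (hm' μ)

/-- The relation says `e h = (h - 2) e`, so `(h - 2) ^ k e = e h ^ k = 0` for large `k`, and `h - 2`
is a unit because `h` is nilpotent. -/
theorem eq_zero_of_isNilpotent_of_commutator {R : Type*} [Ring R] [Algebra ℂ R] {h e : R}
    (he : h * e - e * h = 2 * e) (hn : IsNilpotent h) : e = 0 := by
  obtain ⟨k, hk⟩ := hn
  have hs : SemiconjBy e h (h - 2) := by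
    unfold SemiconjBy
    rw [sub_mul, ← he]; abel
  have h1 := hs.pow_right k
  unfold SemiconjBy at h1
  rw [hk, mul_zero] at h1
  have hu2 : IsUnit (2 : R) := by
    have : IsUnit (algebraMap ℂ R 2) := (IsUnit.mk0 (2 : ℂ) two_ne_zero).map _
    rwa [map_ofNat] at this
  have hu : IsUnit (h - 2) := by
    have := IsNilpotent.isUnit_add_left_of_commute (r := h) (u := -2) ⟨k, hk⟩ hu2.neg
      (Commute.neg_right (Commute.ofNat_right h 2))
    convert this using 1
    abel
  exact ((hu.pow k).mul_right_eq_zero).1 h1.symm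

/-- The non-zero vectors among `e ^ k v` have distinct eigenvalues `μ + 2k`, so they must stop. The
last one is primitive, and its weight is a natural number. -/
theorem exists_int_of_hasEigenvector {h e f : Module.End ℂ W} (t : IsSl2Triple h e f)
    {μ : ℂ} {v : W} (hv : v ≠ 0) (hμ : h v = μ • v) : ∃ z : ℤ, μ = z := by
  have key : ∀ k : ℕ, h ((e ^ k) v) = (μ + 2 * k) • (e ^ k) v := by
    intro k
    induction k with
    | zero => simpa using hμ
    | succ k ih =>
      have h1 : h * e = e * h + 2 • e := by
        rw [← t.lie_h_e_nsmul, Ring.lie_def]; abel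
      have h2 : h (e ((e ^ k) v)) = e (h ((e ^ k) v)) + (2 : ℂ) • e ((e ^ k) v) := by
        have := congrArg (fun g : Module.End ℂ W => g ((e ^ k) v)) h1
        simpa [two_smul] using this
      rw [pow_succ', Module.End.mul_apply, h2, ih, map_smul, ← add_smul]
      congr 1; push_cast; ring
  have hne : ∃ k, (e ^ k) v = 0 := by
    by_contra! hne
    refine Set.infinite_univ_iff.2 (inferInstance : Infinite ℕ) ?_
    have hli := h.eigenvectors_linearIndependent' (fun k : ℕ => μ + 2 * k) (by
      intro a b hab; simpa using hab) (fun k => (e ^ k) v)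
      (fun k => ⟨Module.End.mem_eigenspace_iff.2 (key k), hne k⟩)
    have := hli.finite
    exact Set.finite_univ
  obtain ⟨k, hk, hk'⟩ := Nat.exists_not_and_succ_of_not_zero_of_exists
    (p := fun k => (e ^ k) v = 0) (by simpa using hv) hne
  have hp : t.HasPrimitiveVectorWith ((e ^ k) v) (μ + 2 * k) :=
    ⟨hk, by simpa using key k, by simpa [pow_succ'] using hk'⟩
  obtain ⟨n, hn⟩ := hp.exists_nat
  exact ⟨n - 2 * k, by push_cast; rw [← hn]; ring⟩

/-- The trace is a sum of squares of integer weights with multiplicity. If it vanishes, `0` is the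
only weight, so `h` is nilpotent and the whole triple collapses. Bare relations are assumed instead
of `IsSl2Triple`, which demands `h ≠ 0`, because the image of a triple under a representation may
vanish. -/
theorem exists_nat_trace_mul_self {h e f : Module.End ℂ W} (hef : e * f - f * e = h)
    (he : h * e - e * h = 2 * e) (hf : h * f - f * h = -(2 * f)) :
    ∃ M : ℕ, LinearMap.trace ℂ W (h * h) = M ∧ (h ≠ 0 → M ≠ 0) := by
  by_cases h0 : h = 0
  · exact ⟨0, by simp [h0], fun h => absurd h0 h⟩
  have t : IsSl2Triple h e f := ⟨h0, hef, by rw [Ring.lie_def, he, two_mul, two_smul],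
    by rw [Ring.lie_def, hf, two_mul, two_smul]⟩
  have hfin : {μ : ℂ | h.maxGenEigenspace μ ≠ ⊥}.Finite :=
    WellFoundedGT.finite_ne_bot_of_iSupIndep h.independent_maxGenEigenspace
  have hint : ∀ μ : ℂ, h.maxGenEigenspace μ ≠ ⊥ → ∃ z : ℤ, μ = z := by
    intro μ hμ
    have : h.HasEigenvalue μ := by
      by_contra hc
      apply hμ
      exact (Module.End.hasUnifEigenvalue_iff_hasUnifEigenvalue_one (k := ⊤) (by simp)).not.2 hc
        |> fun h => by simpa [Module.End.HasUnifEigenvalue] using h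
    obtain ⟨v, hv⟩ := this.exists_hasEigenvector
    exact exists_int_of_hasEigenvector t hv.2 hv.apply_eq_smul
  choose! z hz using hint
  refine ⟨∑ μ ∈ hfin.toFinset, (z μ).natAbs ^ 2 * Module.finrank ℂ (h.maxGenEigenspace μ), ?_, ?_⟩
  · rw [trace_mul_self_eq_sum h hfin]
    push_cast
    refine Finset.sum_congr rfl fun μ hμ => ?_
    have h1 := hz μ (by simpa using hμ)
    have h2 : (((z μ).natAbs : ℂ)) ^ 2 = (z μ : ℂ) ^ 2 := by
      have : (((z μ).natAbs : ℤ)) ^ 2 = (z μ) ^ 2 := Int.natAbs_sq _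
      have h3 := congrArg (Int.cast : ℤ → ℂ) this
      push_cast at h3
      simpa using h3
    rw [h2, ← h1]
  · intro _ hM
    rw [Finset.sum_eq_zero_iff] at hM
    have hbot : ∀ μ : ℂ, μ ≠ 0 → h.maxGenEigenspace μ = ⊥ := by
      intro μ hμ
      by_contra hc
      have h1 := hM μ (by simpa using hc)
      rcases Nat.mul_eq_zero.1 h1 with h1 | h1
      · apply hμ
        rw [hz μ hc]
        simpa using h1
      · exact hc (Submodule.finrank_eq_zero.1 h1)
    have htop : h.maxGenEigenspace 0 = ⊤ := by
      rw [← h.iSup_maxGenEigenspace_eq_top]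
      refine le_antisymm (le_iSup (fun μ => h.maxGenEigenspace μ) 0) (iSup_le fun μ => ?_)
      by_cases hμ : μ = 0
      · rw [hμ]
      · rw [hbot μ hμ]; exact bot_le
    have hnil : IsNilpotent h := by
      refine ⟨Module.finrank ℂ W, ?_⟩
      ext v
      have hv : v ∈ h.maxGenEigenspace 0 := htop ▸ Submodule.mem_top
      rw [Module.End.maxGenEigenspace_eq_genEigenspace_finrank, Module.End.mem_genEigenspace_nat] at hv
      simpa using hv
    have he0 := eq_zero_of_isNilpotent_of_commutator he hnil
    exact h0 (by rw [← hef, he0]; simp)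

end SlTwo

theorem exists_nat_matrix_trace_mul_self {m : ℕ} {h e f : Matrix (Fin m) (Fin m) ℂ}
    (hef : ⁅e, f⁆ = h) (he : ⁅h, e⁆ = (2 : ℂ) • e) (hf : ⁅h, f⁆ = -((2 : ℂ) • f)) :
    ∃ M : ℕ, (h * h).trace = M ∧ (h ≠ 0 → M ≠ 0) := by
  rw [Ring.lie_def] at hef he hf
  have h1 := exists_nat_trace_mul_self (h := Matrix.toLin' h) (e := Matrix.toLin' e)
    (f := Matrix.toLin' f)
    (by rw [← hef]; simp [Matrix.toLin'_mul, Module.End.mul_eq_comp])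
    (by rw [Module.End.mul_eq_comp, Module.End.mul_eq_comp, ← Matrix.toLin'_mul, ← Matrix.toLin'_mul,
          ← map_sub, he]; simp [two_smul, two_mul])
    (by rw [Module.End.mul_eq_comp, Module.End.mul_eq_comp, ← Matrix.toLin'_mul, ← Matrix.toLin'_mul,
          ← map_sub, hf]; simp [two_smul, two_mul])
  obtain ⟨M, hM, hM'⟩ := h1
  refine ⟨M, ?_, fun h0 => hM' (by simpa using h0)⟩
  rw [← hM, Module.End.mul_eq_comp, ← Matrix.toLin'_mul, Matrix.trace_toLin'_eq]

/-! ### Invariant forms on simple Lie algebras -/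

/-- The kernel of an invariant form is an ideal, so `B₁` is non-degenerate. For an eigenvalue `c` of
`B₁⁻¹ B₂` the invariant form `B₂ - c B₁` is degenerate, hence zero. -/
theorem exists_smul_eq_of_lieInvariant {L : Type*} [LieRing L] [LieAlgebra ℂ L]
    [FiniteDimensional ℂ L] [LieAlgebra.IsSimple ℂ L] {B₁ B₂ : LinearMap.BilinForm ℂ L}
    (h₁ : B₁.lieInvariant L) (h₂ : B₂.lieInvariant L) (h0 : B₁ ≠ 0) :
    ∃ c : ℂ, B₂ = c • B₁ := by
  have hker : ∀ B : LinearMap.BilinForm ℂ L, B.lieInvariant L →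
      LinearMap.ker B = ⊥ ∨ LinearMap.ker B = ⊤ := by
    intro B hB
    let I : LieIdeal ℂ L :=
      { LinearMap.ker B with
        lie_mem := by
          intro x y hy
          change y ∈ LinearMap.ker B at hy
          change ⁅x, y⁆ ∈ LinearMap.ker B
          rw [LinearMap.mem_ker] at hy ⊢
          ext z
          rw [hB x y z, hy]; simp }
    rcases LieAlgebra.IsSimple.eq_bot_or_eq_top (R := ℂ) I with h | h
    · left
      have : (I : Submodule ℂ L) = ⊥ := by rw [h]; rfl
      exact this
    · right
      have : (I : Submodule ℂ L) = ⊤ := by rw [h]; rfl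
      exact this
  have hb : LinearMap.ker B₁ = ⊥ := (hker B₁ h₁).resolve_right fun h => h0 (LinearMap.ker_eq_top.1 h)
  have hnt : Nontrivial L := by
    by_contra hc
    rw [not_nontrivial_iff_subsingleton] at hc
    exact LieAlgebra.IsSimple.non_abelian ℂ (L := L) ⟨fun x y => Subsingleton.elim _ _⟩
  let E : L ≃ₗ[ℂ] Module.Dual ℂ L := LinearEquiv.ofInjectiveOfFinrankEq B₁
    (LinearMap.ker_eq_bot.1 hb) (Subspace.dual_finrank_eq).symm
  obtain ⟨c, hc⟩ := Module.End.exists_eigenvalue (E.symm.toLinearMap ∘ₗ B₂)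
  obtain ⟨v, hv⟩ := hc.exists_hasEigenvector
  have hv' : B₂ v = c • B₁ v := by
    have := congrArg E hv.apply_eq_smul
    rw [LinearMap.comp_apply, LinearEquiv.coe_coe, E.apply_symm_apply, map_smul] at this
    exact this
  refine ⟨c, ?_⟩
  have hinv : (B₂ - c • B₁).lieInvariant L := by
    intro x y z
    simp [h₁ x y z, h₂ x y z]
    ring

  rcases hker _ hinv with h | h
  · exfalso
    have : v ∈ LinearMap.ker (B₂ - c • B₁) := by simp [hv']
    rw [h, Submodule.mem_bot] at this
    exact hv.2 this
  · exact sub_eq_zero.1 (LinearMap.ker_eq_top.1 h)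

/-- The trace form of a matrix representation. -/
noncomputable def matrixForm {L : Type*} [LieRing L] [LieAlgebra ℂ L] {m : ℕ}
    (φ : L →ₗ⁅ℂ⁆ Matrix (Fin m) (Fin m) ℂ) : LinearMap.BilinForm ℂ L :=
  LinearMap.mk₂ ℂ (fun x y => (φ x * φ y).trace)
    (fun x y z => by simp [add_mul]) (fun c x y => by simp)
    (fun x y z => by simp [mul_add]) (fun c x y => by simp)

theorem matrixForm_apply {L : Type*} [LieRing L] [LieAlgebra ℂ L] {m : ℕ}
    (φ : L →ₗ⁅ℂ⁆ Matrix (Fin m) (Fin m) ℂ) (x y : L) :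
    matrixForm φ x y = (φ x * φ y).trace := rfl

theorem matrixForm_lieInvariant {L : Type*} [LieRing L] [LieAlgebra ℂ L] {m : ℕ}
    (φ : L →ₗ⁅ℂ⁆ Matrix (Fin m) (Fin m) ℂ) : (matrixForm φ).lieInvariant L := by
  intro x y z
  simp only [matrixForm_apply, LieHom.map_lie, Ring.lie_def, sub_mul, mul_sub, Matrix.trace_sub]
  rw [Matrix.mul_assoc, Matrix.trace_mul_comm (φ x), ← Matrix.mul_assoc (φ y) (φ z),
    ← Matrix.mul_assoc (φ y) (φ x)]
  ring

/-! ### The trace form along a diagonal embedding -/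

theorem trace_pi_const {l n : ℕ} (f : Module.End ℂ (Fin n → ℂ)) :
    LinearMap.trace ℂ (Fin l → Fin n → ℂ) (LinearMap.pi fun a => f ∘ₗ LinearMap.proj a) =
      l * LinearMap.trace ℂ _ f := by
  rw [LinearMap.trace_eq_matrix_trace ℂ (Pi.basis fun _ : Fin l => Pi.basisFun ℂ (Fin n)),
    LinearMap.trace_eq_matrix_trace ℂ (Pi.basisFun ℂ (Fin n)), Matrix.trace, Fintype.sum_sigma]
  simp [Matrix.trace, LinearMap.toMatrix_apply, Pi.basis_apply, Pi.basis_repr]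

/-- On a dual summand the two minus signs cancel and `tr(xᵀ yᵀ) = tr((y x)ᵀ) = tr(x y)`, so natural
and dual summands count alike. -/
theorem HasSignature.trace_mul {n m : ℕ} {G : LieSubalgebra ℂ (Matrix (Fin n) (Fin n) ℂ)}
    {H : LieSubalgebra ℂ (Matrix (Fin m) (Fin m) ℂ)} {φ : G →ₗ⁅ℂ⁆ H} {t : Triple}
    (hφ : HasSignature φ t) (x y : G) :
    ((φ x : Matrix (Fin m) (Fin m) ℂ) * φ y).trace =
      ((t.l + t.r : ℕ) : ℂ) * ((x : Matrix (Fin n) (Fin n) ℂ) * (y : Matrix (Fin n) (Fin n) ℂ)).trace := by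
  obtain ⟨e, he⟩ := hφ
  rw [← Matrix.trace_toLin'_eq, ← LinearMap.trace_conj' _ e]
  have : e.conj (Matrix.toLin' ((φ x : Matrix (Fin m) (Fin m) ℂ) * φ y)) =
      LinearMap.prodMap
        (LinearMap.pi fun a => Matrix.toLin' ((x : Matrix (Fin n) (Fin n) ℂ) * (y : Matrix (Fin n) (Fin n) ℂ)) ∘ₗ LinearMap.proj a)
        (LinearMap.prodMap
          (LinearMap.pi fun a => Matrix.toLin'
            ((x : Matrix (Fin n) (Fin n) ℂ).transpose * (y : Matrix (Fin n) (Fin n) ℂ).transpose)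
              ∘ₗ LinearMap.proj a) 0) := by
    refine LinearMap.ext fun w => ?_
    rw [LinearEquiv.conj_apply_apply, Matrix.toLin'_apply, ← Matrix.mulVec_mulVec, he, he]
    simp [LinearMap.prodMap_apply, Matrix.mulVec_neg]
    constructor <;> ext <;> simp
  rw [this, LinearMap.trace_prodMap', LinearMap.trace_prodMap', trace_pi_const, trace_pi_const,
    Matrix.trace_toLin'_eq, Matrix.trace_toLin'_eq, map_zero, ← Matrix.transpose_mul,
    Matrix.trace_transpose, Matrix.trace_mul_comm (y : Matrix (Fin n) (Fin n) ℂ)]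
  push_cast; ring

/-! ### The classical Lie algebras as matrices -/

/-- The matrix of the invariant form of type `X`, zero for type `A`. -/
noncomputable def formMatrix (X : ClassicalType) (n : ℕ) : Matrix (Fin n) (Fin n) ℂ :=
  match X with
  | .A => 0
  | .C => Matrix.of fun i j : Fin n => altEntry i j
  | .O => 1

/-- This lets the three types be treated together: for `A` the zero form makes the first condition
void. -/
theorem mem_classical_iff {X : ClassicalType} {n : ℕ} {M : Matrix (Fin n) (Fin n) ℂ} :
    M ∈ classical X n ↔
      M.transpose * formMatrix X n = -(formMatrix X n * M) ∧ (X = .A → M.trace = 0) := by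
  cases X
  · simp [formMatrix, classical, LieAlgebra.SpecialLinear.sl]
  · simp only [classical, mem_skewAdjointMatricesLieSubalgebra, mem_skewAdjointMatricesSubmodule,
      Matrix.IsSkewAdjoint, Matrix.IsAdjointPair, formMatrix, mul_neg]
    simp
  · simp [classical, formMatrix, LieAlgebra.Orthogonal.mem_so]

/-- The `m × n` matrix whose columns are the first `n` standard basis vectors. -/
def inclMatrix (m n : ℕ) : Matrix (Fin m) (Fin n) ℂ :=
  Matrix.of fun i j => if (i : ℕ) = j then 1 else 0

theorem inclMatrix_transpose_mul {m n : ℕ} (h : n ≤ m) :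
    (inclMatrix m n).transpose * inclMatrix m n = 1 := by
  ext i j
  rw [Matrix.mul_apply, Finset.sum_eq_single (Fin.castLE h i)]
  · simp [inclMatrix, Matrix.one_apply, Fin.ext_iff]
  · intro b _ hb
    have : (b : ℕ) ≠ i := fun h' => hb (Fin.ext h')
    simp [inclMatrix, this]
  · simp

/-- In type `C` evenness of `n` prevents a pair `e_{2k}, e_{2k+1}` from being cut by the edge of the
block. -/
theorem formMatrix_mul_inclMatrix {X : ClassicalType} {m n : ℕ} (h : n ≤ m)
    (hX : X = .C → Even n) :
    formMatrix X m * inclMatrix m n = inclMatrix m n * formMatrix X n := by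
  cases X
  · simp [formMatrix]
  · ext i j
    rw [Matrix.mul_apply, Finset.sum_eq_single (Fin.castLE h j), Matrix.mul_apply]
    · by_cases hi : (i : ℕ) < n
      · rw [Finset.sum_eq_single ⟨i, hi⟩]
        · simp [inclMatrix, formMatrix]
        · intro b _ hb
          have : (i : ℕ) ≠ b := fun h' => hb (Fin.ext h'.symm)
          simp [inclMatrix, this]
        · simp
      · rw [Finset.sum_eq_zero]
        · have h1 : ¬ (Even (i : ℕ) ∧ (j : ℕ) = i + 1) := by
            rintro ⟨_, h2⟩; omega
          have h2 : ¬ (Even (j : ℕ) ∧ (i : ℕ) = j + 1) := by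
            rintro ⟨h3, h4⟩
            have h5 := hX rfl
            have : (j : ℕ) < n := j.2
            rw [Nat.even_iff] at h3 h5
            omega
          simp [inclMatrix, formMatrix, altEntry, h1, h2]
        · intro b _
          have : (i : ℕ) ≠ b := by omega
          simp [inclMatrix, this]
    · intro b _ hb
      have : (b : ℕ) ≠ j := fun h' => hb (Fin.ext h')
      simp [inclMatrix, this]
    · simp
  · simp [formMatrix]

/-- The symmetry type of the invariant form. -/
noncomputable def formSign : ClassicalType → ℂ
  | .A => 1
  | .C => -1
  | .O => 1

theorem formMatrix_transpose (X : ClassicalType) (n : ℕ) :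
    (formMatrix X n).transpose = formSign X • formMatrix X n := by
  cases X
  · simp [formMatrix, formSign]
  · ext i j
    simp only [formMatrix, formSign, altEntry, Matrix.transpose_apply, Matrix.of_apply,
      Matrix.smul_apply, smul_eq_mul]
    by_cases h1 : Even (i : ℕ) ∧ (j : ℕ) = i + 1
    · simp [h1]
    · rw [if_neg h1]
      split_ifs <;> simp
  · simp [formMatrix, formSign]

theorem inclMatrix_transpose_mul_formMatrix {X : ClassicalType} {m n : ℕ} (h : n ≤ m)
    (hX : X = .C → Even n) :
    (inclMatrix m n).transpose * formMatrix X m = formMatrix X n * (inclMatrix m n).transpose := by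
  have := congrArg Matrix.transpose (formMatrix_mul_inclMatrix h hX)
  simp only [Matrix.transpose_mul, formMatrix_transpose, Matrix.mul_smul, Matrix.smul_mul] at this
  have hne : formSign X ≠ 0 := by cases X <;> simp [formSign]
  exact smul_right_injective _ hne this

/-- The matrix `M` as the upper left block of an `m × m` matrix that is zero elsewhere. -/
def pad {n : ℕ} (m : ℕ) (M : Matrix (Fin n) (Fin n) ℂ) : Matrix (Fin m) (Fin m) ℂ :=
  inclMatrix m n * M * (inclMatrix m n).transpose

theorem pad_mul {n m : ℕ} (h : n ≤ m) (M N : Matrix (Fin n) (Fin n) ℂ) :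
    pad m (M * N) = pad m M * pad m N := by
  have h1 := inclMatrix_transpose_mul h
  simp only [pad, Matrix.mul_assoc]
  rw [← Matrix.mul_assoc (inclMatrix m n).transpose (inclMatrix m n), h1, Matrix.one_mul]

theorem pad_sub {n m : ℕ} (M N : Matrix (Fin n) (Fin n) ℂ) :
    pad m (M - N) = pad m M - pad m N := by
  simp [pad, Matrix.mul_sub, Matrix.sub_mul]

theorem pad_smul {n m : ℕ} (c : ℂ) (M : Matrix (Fin n) (Fin n) ℂ) :
    pad m (c • M) = c • pad m M := by
  simp [pad]

theorem pad_neg {n m : ℕ} (M : Matrix (Fin n) (Fin n) ℂ) : pad m (-M) = -pad m M := by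
  simp [pad]

theorem pad_lie {n m : ℕ} (h : n ≤ m) (M N : Matrix (Fin n) (Fin n) ℂ) :
    pad m ⁅M, N⁆ = ⁅pad m M, pad m N⁆ := by
  simp [Ring.lie_def, pad_sub, pad_mul h]

theorem pad_transpose {n m : ℕ} (M : Matrix (Fin n) (Fin n) ℂ) :
    (pad m M).transpose = pad m M.transpose := by
  simp [pad, Matrix.mul_assoc]

theorem trace_pad {n m : ℕ} (h : n ≤ m) (M : Matrix (Fin n) (Fin n) ℂ) :
    (pad m M).trace = M.trace := by
  rw [pad, Matrix.trace_mul_comm, ← Matrix.mul_assoc, inclMatrix_transpose_mul h, Matrix.one_mul]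

theorem pad_mem_classical {X : ClassicalType} {n m : ℕ} (h : n ≤ m) (hX : X = .C → Even n)
    {M : Matrix (Fin n) (Fin n) ℂ} (hM : M ∈ classical X n) : pad m M ∈ classical X m := by
  rw [mem_classical_iff] at hM ⊢
  refine ⟨?_, fun hA => by rw [trace_pad h, hM.2 hA]⟩
  rw [pad_transpose, pad, pad, Matrix.mul_assoc, inclMatrix_transpose_mul_formMatrix h hX,
    ← Matrix.mul_assoc (formMatrix X m), ← Matrix.mul_assoc (formMatrix X m),
    formMatrix_mul_inclMatrix h hX,
    Matrix.mul_assoc (inclMatrix m n) (formMatrix X n), ← Matrix.neg_mul, ← Matrix.mul_neg, ← hM.1]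
  simp only [Matrix.mul_assoc]

/-! ### An `sl₂`-triple in each classical Lie algebra -/

/-- The smallest dimension of a natural module for which the algebra is not abelian. -/
def minDim : ClassicalType → ℕ
  | .A => 2
  | .C => 2
  | .O => 3

/-- The trace of the square of the standard coroot on the natural module. -/
def corootTrace : ClassicalType → ℕ
  | .A => 2
  | .C => 2
  | .O => 8

theorem corootTrace_ne_zero (X : ClassicalType) : (corootTrace X : ℂ) ≠ 0 := by
  cases X <;> simp [corootTrace]

theorem mem_classical_two {M : Matrix (Fin 2) (Fin 2) ℂ} (hM : M 0 0 + M 1 1 = 0) :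
    M ∈ classical .A 2 ∧ M ∈ classical .C 2 := by
  rw [mem_classical_iff, mem_classical_iff]
  refine ⟨⟨by simp [formMatrix], fun _ => by rw [Matrix.trace_fin_two, hM]⟩, ?_, by simp⟩
  have h1 : M 1 1 = -M 0 0 := by linear_combination hM
  ext i j
  fin_cases i <;> fin_cases j <;>
    simp [formMatrix, altEntry, Matrix.mul_apply, Fin.sum_univ_two, h1]

theorem exists_triple_two :
    ∃ h e f : Matrix (Fin 2) (Fin 2) ℂ, (h 0 0 + h 1 1 = 0 ∧ e 0 0 + e 1 1 = 0 ∧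
      f 0 0 + f 1 1 = 0) ∧ e * f - f * e = h ∧ h * e - e * h = (2 : ℂ) • e ∧
      h * f - f * h = -((2 : ℂ) • f) ∧ (h * h).trace = 2 := by
  refine ⟨!![1, 0; 0, -1], !![0, 1; 0, 0], !![0, 0; 1, 0], by simp, ?_, ?_, ?_, ?_⟩
  · simp
  · ext i j; fin_cases i <;> fin_cases j <;> simp; norm_num
  · ext i j; fin_cases i <;> fin_cases j <;> simp; norm_num
  · simp [Matrix.trace_fin_two]; norm_num

/-- The natural module of `so(3)` is the adjoint module of `sl₂`, with weights `2, 0, -2`, hence the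
trace `8`. -/
theorem exists_triple_three :
    ∃ h e f : Matrix (Fin 3) (Fin 3) ℂ, (h.transpose = -h ∧ e.transpose = -e ∧
      f.transpose = -f) ∧ e * f - f * e = h ∧ h * e - e * h = (2 : ℂ) • e ∧
      h * f - f * h = -((2 : ℂ) • f) ∧ (h * h).trace = 8 := by
  have hI := Complex.I_mul_I
  refine ⟨!![0, -2 * Complex.I, 0; 2 * Complex.I, 0, 0; 0, 0, 0],
      !![0, 0, Complex.I; 0, 0, -1; -Complex.I, 1, 0],
      !![0, 0, Complex.I; 0, 0, 1; -Complex.I, -1, 0], ⟨?_, ?_, ?_⟩, ?_, ?_, ?_, ?_⟩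
  case refine_7 =>
    simp [Matrix.trace_fin_three]
    linear_combination (-8) * hI
  all_goals
    ext i j
    fin_cases i <;> fin_cases j <;>
      simp <;>
      first
      | linear_combination 2 * hI
      | linear_combination (-2) * hI
      | ring

theorem exists_triple_minDim (X : ClassicalType) :
    ∃ h e f : Matrix (Fin (minDim X)) (Fin (minDim X)) ℂ,
      h ∈ classical X (minDim X) ∧ e ∈ classical X (minDim X) ∧ f ∈ classical X (minDim X) ∧
      e * f - f * e = h ∧ h * e - e * h = (2 : ℂ) • e ∧ h * f - f * h = -((2 : ℂ) • f) ∧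
      (h * h).trace = corootTrace X := by
  obtain ⟨h, e, f, ⟨hh, he, hf⟩, h1, h2, h3, h4⟩ := exists_triple_two
  cases X
  · exact ⟨h, e, f, (mem_classical_two hh).1, (mem_classical_two he).1, (mem_classical_two hf).1,
      h1, h2, h3, h4.trans (by simp [corootTrace])⟩
  · exact ⟨h, e, f, (mem_classical_two hh).2, (mem_classical_two he).2, (mem_classical_two hf).2,
      h1, h2, h3, h4.trans (by simp [corootTrace])⟩
  · obtain ⟨h, e, f, ⟨hh, he, hf⟩, h1, h2, h3, h4⟩ := exists_triple_three
    have key : ∀ M : Matrix (Fin 3) (Fin 3) ℂ, M.transpose = -M → M ∈ classical .O 3 :=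
      fun M hM => mem_classical_iff.2 ⟨by simpa [formMatrix] using hM, by simp⟩
    exact ⟨h, e, f, key _ hh, key _ he, key _ hf,
      h1, h2, h3, h4.trans (by simp [corootTrace])⟩

/-- Padding by zeros keeps brackets and traces. What matters later is only that the trace does not
depend on `n`. -/
theorem exists_triple {X : ClassicalType} {n : ℕ} (hn : minDim X ≤ n) :
    ∃ h e f : classical X n,
      ⁅e, f⁆ = h ∧ ⁅h, e⁆ = (2 : ℂ) • e ∧ ⁅h, f⁆ = -((2 : ℂ) • f) ∧
      ((h : Matrix (Fin n) (Fin n) ℂ) * (h : Matrix (Fin n) (Fin n) ℂ)).trace = corootTrace X := by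
  obtain ⟨h, e, f, hh, he, hf, h1, h2, h3, h4⟩ := exists_triple_minDim X
  have hX : X = .C → Even (minDim X) := by rintro rfl; exact even_two
  refine ⟨⟨pad n h, pad_mem_classical hn hX hh⟩, ⟨pad n e, pad_mem_classical hn hX he⟩,
    ⟨pad n f, pad_mem_classical hn hX hf⟩, ?_, ?_, ?_, ?_⟩
  · refine Subtype.ext ?_
    rw [LieSubalgebra.coe_bracket, ← pad_lie hn, Ring.lie_def, h1]
  · refine Subtype.ext ?_
    rw [LieSubalgebra.coe_bracket, ← pad_lie hn, Ring.lie_def, h2, pad_smul]; rfl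
  · refine Subtype.ext ?_
    rw [LieSubalgebra.coe_bracket, ← pad_lie hn, Ring.lie_def, h3, pad_neg, pad_smul]; rfl
  · rw [← pad_mul hn, trace_pad hn, h4]

/-- Matrices of size at most `1` commute, and the one further case is `so(2)`, which is
one-dimensional. -/
theorem minDim_le_of_not_isLieAbelian {X : ClassicalType} {n : ℕ}
    (h : ¬ IsLieAbelian (classical X n)) : minDim X ≤ n := by
  by_contra! hlt
  apply h
  refine ⟨fun x y => Subtype.ext ?_⟩
  have hx := (mem_classical_iff.1 x.2).1
  have hy := (mem_classical_iff.1 y.2).1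
  rw [LieSubalgebra.coe_bracket, Ring.lie_def, sub_eq_zero.2]
  · rfl
  rcases Nat.lt_or_ge n 2 with h2 | h2
  · have : Subsingleton (Fin n) := Fin.subsingleton_iff_le_one.2 (by omega)
    ext i j
    obtain rfl := Subsingleton.elim i j
    simp only [Matrix.mul_apply]
    exact Finset.sum_congr rfl fun k _ => by
      obtain rfl := Subsingleton.elim i k
      exact mul_comm _ _
  · cases X
    · simp [minDim] at hlt; omega
    · simp [minDim] at hlt; omega
    · obtain rfl : n = 2 := by simp [minDim] at hlt; omega
      simp only [formMatrix, mul_one, one_mul] at hx hy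
      have key : ∀ z : Matrix (Fin 2) (Fin 2) ℂ, z.transpose = -z →
          z 0 0 = 0 ∧ z 1 1 = 0 ∧ z 1 0 = - z 0 1 := by
        intro z hz
        have e := fun i j => congrFun (congrFun hz i) j
        simp only [Matrix.transpose_apply, Matrix.neg_apply] at e
        exact ⟨self_eq_neg.1 (e 0 0), self_eq_neg.1 (e 1 1), e 0 1⟩
      obtain ⟨a1, a2, a3⟩ := key _ hx
      obtain ⟨b1, b2, b3⟩ := key _ hy
      ext i j
      fin_cases i <;> fin_cases j <;>
        simp [Matrix.mul_apply, Fin.sum_univ_two, a1, a2, a3, b1, b2, b3, mul_comm]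

/-! ### The index of a representation of a diagonal Lie algebra -/

namespace DiagonalExhaustion

variable {X : ClassicalType} {T : ℕ → Triple} {L : Type*} [LieRing L] [LieAlgebra ℂ L]
  (D : DiagonalExhaustion X T L)

theorem sub_mono : Monotone D.sub := monotone_nat_of_le_succ D.le_succ

theorem finiteDimensional_sub (i : ℕ) : FiniteDimensional ℂ (D.sub i) :=
  LinearEquiv.finiteDimensional (D.equiv i).toLinearEquiv.symm

theorem minDim_le (D : DiagonalExhaustion X T L) (i : ℕ) : minDim X ≤ natDim T (i + 1) := by
  refine minDim_le_of_not_isLieAbelian fun h => ?_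
  have := D.simple i
  exact LieAlgebra.IsSimple.non_abelian ℂ (L := D.sub i)
    ((lie_abelian_iff_equiv_lie_abelian (D.equiv i)).2 h)

/-- The natural representation of `D.sub i`. -/
noncomputable def natRep (i : ℕ) :
    D.sub i →ₗ⁅ℂ⁆ Matrix (Fin (natDim T (i + 1))) (Fin (natDim T (i + 1))) ℂ :=
  (classical X (natDim T (i + 1))).incl.comp (D.equiv i).toLieHom

theorem natRep_apply (i : ℕ) (x : D.sub i) :
    D.natRep i x = ((D.equiv i x : classical X (natDim T (i + 1))) : Matrix _ _ ℂ) := rfl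

theorem trace_natRep_succ (i : ℕ) {x : L} (hx : x ∈ D.sub i) :
    (D.natRep (i + 1) ⟨x, D.le_succ i hx⟩ * D.natRep (i + 1) ⟨x, D.le_succ i hx⟩).trace =
      (sSeq T (i + 1) : ℂ) * (D.natRep i ⟨x, hx⟩ * D.natRep i ⟨x, hx⟩).trace := by
  have h := (D.signature i).trace_mul (D.equiv i ⟨x, hx⟩) (D.equiv i ⟨x, hx⟩)
  have h1 : (((D.equiv (i + 1)).toLieHom.comp (LieSubalgebra.inclusion (D.le_succ i))).comp
      (D.equiv i).symm.toLieHom) (D.equiv i ⟨x, hx⟩) = D.equiv (i + 1) ⟨x, D.le_succ i hx⟩ := by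
    change D.equiv (i + 1) (LieSubalgebra.inclusion (D.le_succ i)
      ((D.equiv i).symm (D.equiv i ⟨x, hx⟩))) = _
    rw [LieEquiv.symm_apply_apply]
    rfl
  rw [h1] at h
  exact h

theorem trace_natRep_of_le {i j : ℕ} (hij : i ≤ j) {x : L} (hx : x ∈ D.sub i) :
    (D.natRep j ⟨x, D.sub_mono hij hx⟩ * D.natRep j ⟨x, D.sub_mono hij hx⟩).trace =
      ((∏ k ∈ Finset.Ico i j, sSeq T (k + 1) : ℕ) : ℂ) *
        (D.natRep i ⟨x, hx⟩ * D.natRep i ⟨x, hx⟩).trace := by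
  induction j, hij using Nat.le_induction with
  | base => simp
  | succ j hij ih =>
    rw [D.trace_natRep_succ j (D.sub_mono hij hx), ih, Finset.prod_Ico_succ_top hij]
    push_cast; ring

theorem exists_triple (i : ℕ) :
    ∃ h e f : D.sub i, ⁅e, f⁆ = h ∧ ⁅h, e⁆ = (2 : ℂ) • e ∧ ⁅h, f⁆ = -((2 : ℂ) • f) ∧
      (D.natRep i h * D.natRep i h).trace = corootTrace X := by
  obtain ⟨h, e, f, h1, h2, h3, h4⟩ := DiagonalLie.exists_triple (D.minDim_le i)
  refine ⟨(D.equiv i).symm h, (D.equiv i).symm e, (D.equiv i).symm f, ?_, ?_, ?_, ?_⟩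
  · rw [← LieEquiv.map_lie, h1]
  · rw [← LieEquiv.map_lie, h2]; exact map_smul (D.equiv i).symm.toLinearEquiv _ _
  · rw [← LieEquiv.map_lie, h3]
    have := map_smul (D.equiv i).symm.toLinearEquiv (-2 : ℂ) f
    rw [← neg_smul, ← neg_smul]
    exact this
  · simpa [natRep_apply] using h4

theorem prod_sSeq_ne_zero (hT : IsTripleSeq X T) (s : Finset ℕ) :
    ((∏ k ∈ s, sSeq T (k + 1) : ℕ) : ℂ) ≠ 0 := by
  rw [Nat.cast_ne_zero, Finset.prod_ne_zero_iff]
  intro k _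
  have := hT.l_pos (k + 1)
  unfold sSeq
  omega

/-- There is an element of the first subalgebra whose square has, in each representation of
`D.sub i`, a trace divisible by the product of the `s k` up to `i`. -/
theorem exists_index (hT : IsTripleSeq X T) :
    ∃ h : L, h ≠ 0 ∧ ∃ h0 : h ∈ D.sub 0,
      ∀ (i m : ℕ) (φ : D.sub i →ₗ⁅ℂ⁆ Matrix (Fin m) (Fin m) ℂ), ∃ M : ℕ,
        (φ ⟨h, D.sub_mono (Nat.zero_le i) h0⟩ * φ ⟨h, D.sub_mono (Nat.zero_le i) h0⟩).trace =
          ((M * ∏ k ∈ Finset.range i, sSeq T (k + 1) : ℕ) : ℂ) ∧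
        (φ ⟨h, D.sub_mono (Nat.zero_le i) h0⟩ ≠ 0 → M ≠ 0) := by
  obtain ⟨⟨h, h0⟩, ⟨e, e0⟩, ⟨f, f0⟩, h1, h2, h3, h4⟩ := D.exists_triple 0
  refine ⟨h, ?_, h0, ?_⟩
  · rintro rfl
    have : (⟨0, h0⟩ : D.sub 0) = 0 := rfl
    rw [this, map_zero, zero_mul, Matrix.trace_zero] at h4
    exact corootTrace_ne_zero X h4.symm
  intro i m φ
  have hfd := D.finiteDimensional_sub i
  have hs := D.simple i
  set x : D.sub i := ⟨h, D.sub_mono (Nat.zero_le i) h0⟩ with hx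
  -- `h` has natural trace `corootTrace X` at level `0`, and each inclusion up to level `i`
  -- multiplies it by the next `s`.
  have hxx : matrixForm (D.natRep i) x x =
      ((∏ k ∈ Finset.range i, sSeq T (k + 1) : ℕ) : ℂ) * corootTrace X := by
    rw [matrixForm_apply, D.trace_natRep_of_le (Nat.zero_le i) h0, h4, Finset.range_eq_Ico]
  have hne : matrixForm (D.natRep i) ≠ 0 := by
    intro hc
    rw [hc] at hxx
    exact mul_ne_zero (prod_sSeq_ne_zero hT _) (corootTrace_ne_zero X) hxx.symm
  obtain ⟨c, hc⟩ := exists_smul_eq_of_lieInvariant (matrixForm_lieInvariant (D.natRep i))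
    (matrixForm_lieInvariant φ) hne
  -- A second triple, native to level `i`, with the same natural trace. It shows that `c *
  -- corootTrace X` is a natural number, so the unknown constant `corootTrace X` cancels.
  obtain ⟨h', e', f', h1', h2', h3', h4'⟩ := D.exists_triple i
  obtain ⟨M, hM, -⟩ := exists_nat_matrix_trace_mul_self (h := φ h') (e := φ e') (f := φ f')
    (by rw [← LieHom.map_lie, h1']) (by rw [← LieHom.map_lie, h2', map_smul])
    (by rw [← LieHom.map_lie, h3', map_neg, map_smul])
  have hcM : c * corootTrace X = M := by
    rw [← hM, ← matrixForm_apply, hc, ← h4']; rfl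
  have hval : (φ x * φ x).trace = ((M * ∏ k ∈ Finset.range i, sSeq T (k + 1) : ℕ) : ℂ) := by
    rw [← matrixForm_apply, hc, LinearMap.smul_apply, LinearMap.smul_apply, hxx, Nat.cast_mul, ← hcM,
      smul_eq_mul]
    ring
  refine ⟨M, hval, fun hφ hM0 => ?_⟩
  -- Non-vanishing is read off from the original triple of level `0`, now regarded inside level `i`.
  have hi := D.sub_mono (Nat.zero_le i)
  have r1 : ⁅(⟨e, hi e0⟩ : D.sub i), ⟨f, hi f0⟩⁆ = x :=
    Subtype.ext (congrArg (Subtype.val : D.sub 0 → L) h1)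
  have r2 : ⁅x, (⟨e, hi e0⟩ : D.sub i)⁆ = (2 : ℂ) • ⟨e, hi e0⟩ :=
    Subtype.ext (congrArg (Subtype.val : D.sub 0 → L) h2)
  have r3 : ⁅x, (⟨f, hi f0⟩ : D.sub i)⁆ = -((2 : ℂ) • ⟨f, hi f0⟩) :=
    Subtype.ext (congrArg (Subtype.val : D.sub 0 → L) h3)
  obtain ⟨M', hM', hM''⟩ := exists_nat_matrix_trace_mul_self (h := φ x) (e := φ ⟨e, hi e0⟩)
    (f := φ ⟨f, hi f0⟩)
    (by rw [← LieHom.map_lie, r1]) (by rw [← LieHom.map_lie, r2, map_smul])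
    (by rw [← LieHom.map_lie, r3, map_neg, map_smul])
  refine hM'' hφ ?_
  rw [hval, hM0, zero_mul, Nat.cast_inj] at hM'
  exact hM'.symm

/-- A finite-dimensional subspace lies in one of the subalgebras. -/
theorem exists_range_le {E : Type*} [AddCommGroup E] [Module ℂ E] [FiniteDimensional ℂ E]
    (g : E →ₗ[ℂ] L) : ∃ j, ∀ x, g x ∈ D.sub j := by
  let b := Module.finBasis ℂ E
  choose j hj using fun k => D.exhausts (g (b k))
  refine ⟨Finset.univ.sup j, fun x => ?_⟩
  rw [← b.sum_repr x, map_sum]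
  refine sum_mem fun k _ => ?_
  rw [map_smul]
  exact (D.sub _).smul_mem _ (D.sub_mono (Finset.le_sup (Finset.mem_univ k)) (hj k))

end DiagonalExhaustion

/-! ### Divisibility of Steinitz numbers -/

/-- The exponents of `Stz s` are suprema over partial products, so each partial product can be
bounded separately. -/
theorem divides_of_prod_dvd {s t : ℕ → ℕ} (ht : ∀ i, t i ≠ 0) {N : ℕ} (hN : N ≠ 0)
    (h : ∀ k, ∃ j, (∏ i ∈ Finset.range k, s i) ∣ N * ∏ i ∈ Finset.range j, t i) :
    (Stz s).Divides ((SteinitzNumber.ofPosNat N).mul (Stz t)) := by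
  intro p
  have := Fact.mk p.2
  refine iSup_le fun k => ?_
  obtain ⟨j, hj⟩ := h k
  have ht' : ∏ i ∈ Finset.range j, t i ≠ 0 := Finset.prod_ne_zero_iff.2 fun i _ => ht i
  have h1 : SteinitzNumber.ofPosNat (∏ i ∈ Finset.range k, s i) p ≤
      SteinitzNumber.ofPosNat N p + SteinitzNumber.ofPosNat (∏ i ∈ Finset.range j, t i) p := by
    unfold SteinitzNumber.ofPosNat
    rw [← Nat.cast_add, ← padicValNat.mul hN ht']
    exact_mod_cast (padicValNat_dvd_iff_le (mul_ne_zero hN ht')).1 (pow_padicValNat_dvd.trans hj)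
  refine h1.trans (add_le_add le_rfl ?_)
  exact le_iSup (fun k => SteinitzNumber.ofPosNat (∏ i ∈ Finset.range k, t i) p) j

theorem sSeq_ne_zero {X : ClassicalType} {T : ℕ → Triple} (hT : IsTripleSeq X T) (i : ℕ) :
    sSeq T i ≠ 0 := by
  have := hT.l_pos i
  unfold sSeq
  omega

/-- The trace of `f(h)²` on one natural module of the target is computed in two ways: by climbing
the target from a fixed level, and by `exists_index` for the source at level `k`. -/
theorem stz_divides_of_injective {X₁ X₂ : ClassicalType} {T₁ T₂ : ℕ → Triple}
    {L₁ L₂ : Type*} [LieRing L₁] [LieAlgebra ℂ L₁] [LieRing L₂] [LieAlgebra ℂ L₂]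
    (hT₁ : IsTripleSeq X₁ T₁) (hT₂ : IsTripleSeq X₂ T₂)
    (D₁ : DiagonalExhaustion X₁ T₁ L₁) (D₂ : DiagonalExhaustion X₂ T₂ L₂)
    (f : L₁ →ₗ⁅ℂ⁆ L₂) (hf : Function.Injective f) :
    ∃ N : ℕ, 0 < N ∧
      (Stz (sSeq T₁)).Divides ((SteinitzNumber.ofPosNat N).mul (Stz (sSeq T₂))) := by
  obtain ⟨h, hne, h0, hidx⟩ := D₁.exists_index hT₁
  let g : ∀ i, D₁.sub i →ₗ⁅ℂ⁆ L₂ := fun i => f.comp (D₁.sub i).incl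
  have hex : ∀ i, ∃ j, ∀ x : D₁.sub i, g i x ∈ D₂.sub j := fun i => by
    have := D₁.finiteDimensional_sub i
    exact D₂.exists_range_le (g i : D₁.sub i →ₗ[ℂ] L₂)
  let φ : ∀ i j, (∀ x : D₁.sub i, g i x ∈ D₂.sub j) →
      (D₁.sub i →ₗ⁅ℂ⁆ Matrix (Fin (natDim T₂ (j + 1))) (Fin (natDim T₂ (j + 1))) ℂ) :=
    fun i j hij => (D₂.natRep j).comp
      { ((g i : D₁.sub i →ₗ[ℂ] L₂).codRestrict (D₂.sub j).toSubmodule hij) with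
        map_lie' := fun {x y} => Subtype.ext ((g i).map_lie x y) }
  have hφ : ∀ i j hij x, φ i j hij x = D₂.natRep j ⟨f x, hij x⟩ := fun _ _ _ _ => rfl
  obtain ⟨j0, hj0⟩ := hex 0
  obtain ⟨N, hN, hN0⟩ := hidx 0 _ (φ 0 j0 hj0)
  have hN0' : N ≠ 0 := by
    refine hN0 fun hz => hne (hf ?_)
    rw [hφ] at hz
    have h1 : D₂.equiv j0 ⟨f h, hj0 ⟨h, h0⟩⟩ = 0 := Subtype.ext hz
    have h2 : (⟨f h, hj0 ⟨h, h0⟩⟩ : D₂.sub j0) = 0 :=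
      (D₂.equiv j0).injective (h1.trans (map_zero (D₂.equiv j0).toLinearEquiv).symm)
    rw [map_zero]
    exact congrArg Subtype.val h2
  have hpos := sSeq_ne_zero hT₁ 0
  -- The term of index `0` belongs to no inclusion of the exhaustion and is not seen by the traces,
  -- so it is put into the constant.
  refine ⟨sSeq T₁ 0 * N, Nat.pos_of_ne_zero (mul_ne_zero hpos hN0'), ?_⟩
  refine divides_of_prod_dvd (sSeq_ne_zero hT₂) (mul_ne_zero hpos hN0') fun k => ?_
  obtain ⟨j1, hj1⟩ := hex k
  -- The level must contain the image of level `k` and lie above `j0`, where `N` was measured.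
  set j := max j0 j1
  have hj : ∀ x : D₁.sub k, g k x ∈ D₂.sub j := fun x => D₂.sub_mono (le_max_right j0 j1) (hj1 x)
  obtain ⟨M, hM, -⟩ := hidx k _ (φ k j hj)
  have hfh : f h ∈ D₂.sub j0 := hj0 ⟨h, h0⟩
  have hN' : (D₂.natRep j0 ⟨f h, hfh⟩ * D₂.natRep j0 ⟨f h, hfh⟩).trace = (N : ℂ) := by
    simpa [hφ] using hN
  have hkey : N * ∏ i ∈ Finset.Ico j0 j, sSeq T₂ (i + 1) =
      M * ∏ i ∈ Finset.range k, sSeq T₁ (i + 1) := by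
    have h1 := D₂.trace_natRep_of_le (le_max_left j0 j1) hfh
    rw [hN'] at h1
    have h2 := h1.symm.trans hM
    rw [← Nat.cast_mul, Nat.cast_inj] at h2
    rw [mul_comm N]
    exact h2
  -- The inclusions from `j0` to `j` carry the indices `j0 + 1, …, j`. The remaining factors of the
  -- longer product only enlarge the right-hand side.
  refine ⟨j + 1, ?_⟩
  have h3 : (∏ i ∈ Finset.range k, sSeq T₁ i) ∣
      sSeq T₁ 0 * ∏ i ∈ Finset.range k, sSeq T₁ (i + 1) := by
    rw [mul_comm, ← Finset.prod_range_succ']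
    exact Finset.prod_dvd_prod_of_subset _ _ _ (Finset.range_mono (Nat.le_succ k))
  refine h3.trans ?_
  rw [mul_assoc]
  refine mul_dvd_mul_left _ ?_
  refine (Dvd.intro_left M hkey.symm).trans (mul_dvd_mul_left _ ?_)
  rw [Finset.prod_range_succ']
  refine Dvd.dvd.mul_right ?_ _
  exact Finset.prod_dvd_prod_of_subset _ _ _ (by
    rw [Finset.range_eq_Ico]; exact Finset.Ico_subset_Ico_left (Nat.zero_le _))

/-! ### Normal forms of symmetric and alternating forms -/

/-- The entries of the matrix of the invariant form of type `X`. -/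
noncomputable def formEntry : ClassicalType → ℕ → ℕ → ℂ
  | .A, _, _ => 0
  | .C, i, j => altEntry i j
  | .O, i, j => if i = j then 1 else 0

theorem formMatrix_apply (X : ClassicalType) {n : ℕ} (i j : Fin n) :
    formMatrix X n i j = formEntry X i j := by
  cases X <;> simp [formMatrix, formEntry, Matrix.one_apply, Fin.ext_iff]

/-- The index paired with `i` by the standard alternating form. -/
def altPartner (i : ℕ) : ℕ := if Even i then i + 1 else i - 1

theorem altEntry_eq_zero {i j : ℕ} (h : j ≠ altPartner i) : altEntry i j = 0 := by
  unfold altPartner at h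
  unfold altEntry
  rw [if_neg, if_neg]
  · rintro ⟨h1, h2⟩
    have : ¬ Even i := by rw [h2, Nat.even_add_one]; simpa using h1
    rw [if_neg this] at h
    omega
  · rintro ⟨h1, h2⟩
    rw [if_pos h1] at h
    exact h h2

theorem altEntry_altPartner (i : ℕ) : altEntry i (altPartner i) = if Even i then 1 else -1 := by
  unfold altEntry altPartner
  by_cases h : Even i
  · simp [h]
  · have h1 : Odd i := Nat.not_even_iff_odd.1 h
    obtain ⟨k, rfl⟩ := h1
    have h2 : Even (2 * k) := even_two_mul k
    simp [h2]

theorem altPartner_lt {n i : ℕ} (hn : Even n) (hi : i < n) : altPartner i < n := by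
  unfold altPartner
  rw [Nat.even_iff] at hn
  split_ifs with h
  · rw [Nat.even_iff] at h; omega
  · omega

theorem altPartner_altPartner (i : ℕ) : altPartner (altPartner i) = i := by
  unfold altPartner
  by_cases h : Even i
  · have : ¬ Even (i + 1) := by rw [Nat.even_add_one]; simpa using h
    simp [h, this]
  · obtain ⟨k, rfl⟩ := Nat.not_even_iff_odd.1 h
    have h2 : Even (2 * k) := even_two_mul k
    simp [h2]

/-- In type `C` this is a signed permutation matrix, evenness keeping every partner index in range.
In type `O` it is the identity. -/
theorem formMatrix_mul_transpose {X : ClassicalType} {n : ℕ} (hA : X ≠ .A) (hC : X = .C → Even n) :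
    formMatrix X n * (formMatrix X n).transpose = 1 := by
  cases X
  · exact absurd rfl hA
  · ext i k
    have hi := altPartner_lt (hC rfl) i.2
    rw [Matrix.mul_apply, Finset.sum_eq_single ⟨altPartner i, hi⟩]
    · by_cases hik : i = k
      · subst hik
        simp only [Matrix.transpose_apply, formMatrix_apply, formEntry, altEntry_altPartner,
          Matrix.one_apply_eq]
        split_ifs <;> simp
      · have : altPartner i ≠ altPartner k := fun h => hik (Fin.ext (by
          rw [← altPartner_altPartner i, h, altPartner_altPartner]))
        simp only [Matrix.transpose_apply, formMatrix_apply, formEntry, altEntry_eq_zero this,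
          mul_zero, Matrix.one_apply_ne hik]
    · intro b _ hb
      have : (b : ℕ) ≠ altPartner i := fun h => hb (Fin.ext h)
      simp [formMatrix_apply, formEntry, altEntry_eq_zero this]
    · simp
  · simp [formMatrix]

section NormalForm

variable {W : Type*} [AddCommGroup W] [Module ℂ W] [FiniteDimensional ℂ W]

/-- The inductive step shared by both normal forms. A dimension count gives `v`, non-degeneracy
gives a partner, and subtracting a combination of the `f i` from the partner does not affect its
pairing with `v`. -/
theorem exists_orthogonal_pair {X : ClassicalType} (hA : X ≠ .A) (B : LinearMap.BilinForm ℂ W)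
    (hB : ∀ v, (∀ w, B v w = 0) → v = 0) {k : ℕ} (hC : X = .C → Even k) (hk : k < Module.finrank ℂ W) (f : ℕ → W)
    (hf : ∀ i < k, ∀ j < k, B (f i) (f j) = formEntry X i j) :
    ∃ v w, B v w = 1 ∧ (∀ i < k, B v (f i) = 0) ∧ ∀ i < k, B w (f i) = 0 := by
  obtain ⟨v, hv, hv0⟩ : ∃ v, (∀ i < k, B v (f i) = 0) ∧ v ≠ 0 := by
    let Φ : W →ₗ[ℂ] (Fin k → ℂ) := LinearMap.pi fun i => B.flip (f i)
    have := LinearMap.ker_ne_bot_of_finrank_lt (f := Φ) (by simpa using hk)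
    obtain ⟨v, hv, hv0⟩ := (Submodule.ne_bot_iff _).1 this
    refine ⟨v, fun i hi => ?_, hv0⟩
    exact congrFun (LinearMap.mem_ker.1 hv) ⟨i, hi⟩
  obtain ⟨w₁, hw₁⟩ : ∃ w, B v w ≠ 0 := by
    by_contra! h
    exact hv0 (hB v h)
  set w₀ := (B v w₁)⁻¹ • w₁ with hw₀
  have hvw : B v w₀ = 1 := by simp [hw₀, hw₁]
  set β : Fin k → ℂ := fun j => B w₀ (f j) with hβ
  -- The coefficients of the projection to the span of the `f i`: the solution of `c J = β`, as `Jᵀ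
  -- J = 1`.
  set c := Matrix.vecMul β (formMatrix X k).transpose with hc
  have hcJ : Matrix.vecMul c (formMatrix X k) = β := by
    rw [hc, Matrix.vecMul_vecMul, mul_eq_one_comm.1 (formMatrix_mul_transpose hA hC),
      Matrix.vecMul_one]
  refine ⟨v, w₀ - ∑ i, c i • f i, ?_, hv, fun j hj => ?_⟩
  · rw [map_sub, map_sum, hvw, Finset.sum_eq_zero, sub_zero]
    intro i _
    rw [map_smul, hv i i.2, smul_zero]
  · have h1 := congrFun hcJ ⟨j, hj⟩
    rw [Matrix.vecMul, dotProduct] at h1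
    rw [map_sub, map_sum, LinearMap.sub_apply, LinearMap.sum_apply, sub_eq_zero]
    rw [← show β ⟨j, hj⟩ = B w₀ (f j) from rfl, ← h1]
    refine Finset.sum_congr rfl fun i _ => ?_
    rw [map_smul, LinearMap.smul_apply, hf i i.2 j hj, formMatrix_apply, smul_eq_mul]

theorem exists_orthonormal_family (B : LinearMap.BilinForm ℂ W)
    (hB : ∀ v, (∀ w, B v w = 0) → v = 0) (hs : ∀ v w, B w v = B v w)
    (k : ℕ) (hk : k ≤ Module.finrank ℂ W) :
    ∃ f : ℕ → W, ∀ i < k, ∀ j < k, B (f i) (f j) = formEntry .O i j := by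
  induction k with
  | zero => exact ⟨0, by simp⟩
  | succ k ih =>
    obtain ⟨f, hf⟩ := ih (by omega)
    obtain ⟨v, w, hvw, hv, hw⟩ := exists_orthogonal_pair (X := .O) (by simp) B hB
      (by simp) hk f hf
    -- Polarisation: if `v`, `w` and `v + w` were all isotropic, then `2 B v w = 0`.
    obtain ⟨x, hx, hx0⟩ : ∃ x, (∀ i < k, B x (f i) = 0) ∧ B x x ≠ 0 := by
      by_contra! h
      have h1 := h v hv
      have h2 := h w hw
      have h3 := h (v + w) (fun i hi => by simp [hv i hi, hw i hi])
      simp [h1, h2, hs v w, hvw] at h3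
    obtain ⟨c, hc⟩ := IsAlgClosed.exists_eq_mul_self (B x x)
    have hc0 : c ≠ 0 := by rintro rfl; simp at hc; exact hx0 hc
    refine ⟨fun i => if i < k then f i else c⁻¹ • x, fun i hi j hj => ?_⟩
    by_cases hik : i < k <;> by_cases hjk : j < k
    · simp only [hik, hjk, if_true]; exact hf i hik j hjk
    · have : i ≠ j := by omega
      simp [hik, hjk, hs x, hx i hik, formEntry, this]
    · have : i ≠ j := by omega
      simp [hik, hjk, hx j hjk, formEntry, this]
    · have : i = j := by omega
      simp [hjk, this, hc, formEntry, hc0]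

theorem exists_symplectic_family (B : LinearMap.BilinForm ℂ W)
    (hB : ∀ v, (∀ w, B v w = 0) → v = 0) (hs : ∀ v w, B w v = -B v w)
    (k : ℕ) (hk : 2 * k ≤ Module.finrank ℂ W) :
    ∃ f : ℕ → W, ∀ i < 2 * k, ∀ j < 2 * k, B (f i) (f j) = formEntry .C i j := by
  induction k with
  | zero => exact ⟨0, by simp⟩
  | succ k ih =>
    obtain ⟨f, hf⟩ := ih (by omega)
    have he : Even (2 * k) := even_two_mul k
    obtain ⟨v, w, hvw, hv, hw⟩ := exists_orthogonal_pair (X := .C) (by simp) B hB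
      (fun _ => he) (by omega) f hf
    have hself : ∀ x, B x x = 0 := fun x => self_eq_neg.1 (hs x x)
    have hpart : ∀ i < 2 * k, altPartner i < 2 * k := fun i hi => altPartner_lt he hi
    refine ⟨fun i => if i < 2 * k then f i else if i = 2 * k then v else w,
      fun i hi j hj => ?_⟩
    by_cases hik : i < 2 * k <;> by_cases hjk : j < 2 * k
    · simp only [hik, hjk, if_true]; exact hf i hik j hjk
    · have h1 : altEntry i j = 0 := altEntry_eq_zero (by have := hpart i hik; omega)
      simp only [hik, hjk, if_true, if_false, formEntry, h1]
      split_ifs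
      · rw [hs v, hv i hik, neg_zero]
      · rw [hs w, hw i hik, neg_zero]
    · have h1 : altEntry i j = 0 := altEntry_eq_zero (by
        intro h
        have := hpart j hjk
        rw [h, altPartner_altPartner] at this
        exact hik this)
      simp only [hik, hjk, if_true, if_false, formEntry, h1]
      split_ifs
      · exact hv j hjk
      · exact hw j hjk
    · have hi' : i = 2 * k ∨ i = 2 * k + 1 := by omega
      have hj' : j = 2 * k ∨ j = 2 * k + 1 := by omega
      rcases hi' with rfl | rfl <;> rcases hj' with rfl | rfl <;>
        simp [formEntry, altEntry, hself, hvw, hs v w]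

end NormalForm

theorem exists_transpose_mul_mul_eq {X : ClassicalType} (hA : X ≠ .A) {z : ℕ}
    (hC : X = .C → Even z) {S S' : Matrix (Fin z) (Fin z) ℂ} (hS : S * S' = 1)
    (hs : S.transpose = formSign X • S) :
    ∃ d : Matrix (Fin z) (Fin z) ℂ, d.transpose * S * d = formMatrix X z := by
  set B : LinearMap.BilinForm ℂ (Fin z → ℂ) := Matrix.toLinearMap₂' ℂ S with hBdef
  have hBv : ∀ v w, B v w = v ⬝ᵥ S.mulVec w := fun v w => Matrix.toLinearMap₂'_apply' S v w
  have hB : ∀ v, (∀ w, B v w = 0) → v = 0 := by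
    intro v hv
    have h1 : ∀ w, v ⬝ᵥ w = 0 := fun w => by
      have := hv (S'.mulVec w)
      rwa [hBv, Matrix.mulVec_mulVec, hS, Matrix.one_mulVec] at this
    exact dotProduct_eq_zero v h1
  have hsym : ∀ v w, B w v = formSign X * B v w := by
    intro v w
    rw [hBv, hBv, Matrix.dotProduct_mulVec, ← Matrix.mulVec_transpose, hs, Matrix.smul_mulVec,
      smul_dotProduct, dotProduct_comm, smul_eq_mul]
  obtain ⟨f, hf⟩ : ∃ f : ℕ → (Fin z → ℂ), ∀ i < z, ∀ j < z, B (f i) (f j) = formEntry X i j := by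
    cases X
    · exact absurd rfl hA
    · obtain ⟨k, rfl⟩ := even_iff_two_dvd.1 (hC rfl)
      obtain ⟨f, hf⟩ := exists_symplectic_family B hB
        (fun v w => by rw [hsym v w, formSign, neg_one_mul]) k (by simp)
      exact ⟨f, hf⟩
    · exact exists_orthonormal_family B hB (fun v w => by rw [hsym v w, formSign, one_mul]) z
        (by simp)
  -- The columns of `d` are the vectors of the adapted basis.
  refine ⟨Matrix.of fun i j => f j i, ?_⟩
  ext i j
  rw [formMatrix_apply, ← hf i i.2 j j.2, hBv, Matrix.mul_assoc, Matrix.mul_apply]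
  rfl

/-! ### The natural module of a classical Lie algebra -/

theorem single_sub_single_mem_classical {n : ℕ} (i j : Fin n) :
    Matrix.single i j (1 : ℂ) - Matrix.single j i 1 ∈ classical .O n := by
  rw [mem_classical_iff]
  refine ⟨?_, by simp⟩
  simp [formMatrix]

/-- The rank-one elements `v ↦ ⟨x, v⟩ x` of `sp(n)`, used below as test elements. -/
theorem vecMulVec_mem_classical {n : ℕ} (x : Fin n → ℂ) :
    Matrix.vecMulVec x (Matrix.vecMul x (formMatrix .C n)) ∈ classical .C n := by
  rw [mem_classical_iff]
  refine ⟨?_, by simp⟩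
  have h : (formMatrix .C n).mulVec x = -Matrix.vecMul x (formMatrix .C n) := by
    rw [← Matrix.vecMul_transpose, formMatrix_transpose, formSign, neg_one_smul, Matrix.vecMul_neg]
  rw [Matrix.transpose_vecMulVec, Matrix.vecMulVec_mul, Matrix.mul_vecMulVec, h,
    Matrix.neg_vecMulVec, neg_neg]

theorem eq_zero_of_forall_mulVec_eq_zero {X : ClassicalType} {n : ℕ} (hA : X ≠ .A)
    (hn : minDim X ≤ n) (hC : X = .C → Even n) {v : Fin n → ℂ}
    (h : ∀ y ∈ classical X n, y.mulVec v = 0) : v = 0 := by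
  cases X
  · exact absurd rfl hA
  · have h1 : (formMatrix .C n).mulVec v = 0 := by
      ext i
      have h2 := congrFun (h _ (vecMulVec_mem_classical (Pi.single i 1))) i
      rw [Matrix.vecMulVec_mulVec, Matrix.single_one_vecMul] at h2
      simpa [Matrix.mulVec, Matrix.row] using h2
    have h3 := congrArg (formMatrix .C n).transpose.mulVec h1
    rwa [Matrix.mulVec_mulVec, mul_eq_one_comm.1 (formMatrix_mul_transpose hA hC),
      Matrix.one_mulVec, Matrix.mulVec_zero] at h3
  · ext j
    obtain ⟨i, hi⟩ : ∃ i : Fin n, i ≠ j := by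
      have : Nontrivial (Fin n) := Fin.nontrivial_iff_two_le.2 (by simp [minDim] at hn; omega)
      exact exists_ne j
    have h2 := congrFun (h _ (single_sub_single_mem_classical i j)) i
    simpa [Matrix.sub_mulVec, Matrix.single_mulVec, hi] using h2

/-- Schur's lemma for the natural module, by hand. In type `C`, commuting with the rank-one elements
makes every vector an eigenvector of `M`. In type `O`, entries are compared after commuting with
`E_ij - E_ji`. -/
theorem exists_eq_smul_one_of_commute {X : ClassicalType} {n : ℕ} (hA : X ≠ .A)
    (hn : minDim X ≤ n) (hC : X = .C → Even n) {M : Matrix (Fin n) (Fin n) ℂ}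
    (h : ∀ y ∈ classical X n, M * y = y * M) : ∃ c : ℂ, M = c • 1 := by
  cases X
  · exact absurd rfl hA
  · have key : ∀ x : Fin n → ℂ, ∃ c : ℂ, M.mulVec x = c • x := by
      intro x
      have h1 := h _ (vecMulVec_mem_classical x)
      rw [Matrix.mul_vecMulVec, Matrix.vecMulVec_mul] at h1
      by_cases hx : x = 0
      · exact ⟨0, by simp [hx]⟩
      have hxJ : Matrix.vecMul x (formMatrix .C n) ≠ 0 := fun h0 => hx (by
        have := congrArg (fun y => Matrix.vecMul y (formMatrix .C n).transpose) h0
        simpa [Matrix.vecMul_vecMul, formMatrix_mul_transpose hA hC] using this)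
      obtain ⟨b, hb⟩ := Function.ne_iff.1 hxJ
      simp only [Pi.zero_apply] at hb
      refine ⟨(Matrix.vecMul (Matrix.vecMul x (formMatrix .C n)) M b) /
        Matrix.vecMul x (formMatrix .C n) b, ?_⟩
      ext k
      have h2 := congrFun (congrFun h1 k) b
      simp only [Matrix.vecMulVec_apply] at h2
      rw [Pi.smul_apply, smul_eq_mul, div_mul_eq_mul_div, eq_div_iff hb, h2]
      ring
    have key1 : ∀ i k : Fin n, k ≠ i → M k i = 0 := by
      intro i k hki
      obtain ⟨c, hc⟩ := key (Pi.single i 1)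
      have := congrFun hc k
      simpa [hki] using this
    have key2 : ∀ i j : Fin n, i ≠ j → M i i = M j j := by
      intro i j hij
      obtain ⟨c, hc⟩ := key (Pi.single i 1 + Pi.single j 1)
      have h1 := congrFun hc i
      have h2 := congrFun hc j
      simp [Matrix.mulVec_add, hij, hij.symm, key1 j i hij, key1 i j hij.symm] at h1 h2
      rw [h1, h2]
    have h0 : 0 < n := lt_of_lt_of_le (by simp [minDim]) hn
    refine ⟨M ⟨0, h0⟩ ⟨0, h0⟩, ?_⟩
    ext k i
    by_cases hki : k = i
    · subst hki
      by_cases hk : k = ⟨0, h0⟩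
      · simp [hk]
      · simp [key2 _ _ hk]
    · simp [key1 i k hki, hki]
  · have hn' : 3 ≤ n := hn
    have e1 : ∀ i j k : Fin n, i ≠ j → M k i =
        (if k = i then M j j else 0) - (if k = j then M i j else 0) := by
      intro i j k hij
      have h2 := congrFun (congrFun (h _ (single_sub_single_mem_classical i j)) k) j
      simp only [mul_sub, sub_mul, Matrix.sub_apply] at h2
      have h3 : (M * Matrix.single i j (1 : ℂ) : Matrix (Fin n) (Fin n) ℂ) k j = M k i := by simp
      have h4 : (M * Matrix.single j i (1 : ℂ) : Matrix (Fin n) (Fin n) ℂ) k j = 0 := by simp [hij.symm]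
      have h5 : ∀ a b : Fin n, (Matrix.single a b (1 : ℂ) * M : Matrix (Fin n) (Fin n) ℂ) k j = if k = a then M b j else 0 := by
        intro a b
        split_ifs with hka
        · subst hka; simp
        · simp [hka]
      rw [h3, h4, h5, h5, sub_zero] at h2
      exact h2
    -- A third index kills the off-diagonal entries. This needs `n ≥ 3`; the abelian algebra `so(2)`
    -- has non-scalar commutant.
    have hex : ∀ k i : Fin n, ∃ j, j ≠ k ∧ j ≠ i := by
      intro k i
      have : ({k, i} : Finset (Fin n)).card < Fintype.card (Fin n) := by
        rw [Fintype.card_fin]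
        exact lt_of_le_of_lt Finset.card_le_two hn'
      obtain ⟨j, hj⟩ := Finset.exists_mem_notMem_of_card_lt_card (s := {k, i}) (t := Finset.univ)
        (by simpa using this)
      exact ⟨j, by simpa using hj⟩
    have h0 : 0 < n := by omega
    refine ⟨M ⟨0, h0⟩ ⟨0, h0⟩, ?_⟩
    ext k i
    by_cases hki : k = i
    · subst hki
      by_cases hk : k = ⟨0, h0⟩
      · simp [hk]
      · simp [e1 k ⟨0, h0⟩ k hk, hk]
    · obtain ⟨j, hjk, hji⟩ := hex k i
      simp [e1 i j k hji.symm, hki, hjk.symm]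

/-! ### Normal form of an embedding of signature `(1, 0, z)` -/

/-- The decomposition `V ⊕ T^z` in matrix form: `u`, `w` are the inclusions of the two summands and
`p`, `q` the projections. -/
theorem HasSignature.exists_splitting {n m : ℕ} {G : LieSubalgebra ℂ (Matrix (Fin n) (Fin n) ℂ)}
    {H : LieSubalgebra ℂ (Matrix (Fin m) (Fin m) ℂ)} {φ : G →ₗ⁅ℂ⁆ H} {t : Triple}
    (hφ : HasSignature φ t) (hl : t.l = 1) (hr : t.r = 0) :
    ∃ (z : ℕ) (u : Matrix (Fin m) (Fin n) ℂ) (w : Matrix (Fin m) (Fin z) ℂ)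
      (p : Matrix (Fin n) (Fin m) ℂ) (q : Matrix (Fin z) (Fin m) ℂ),
      m = n + z ∧ p * u = 1 ∧ q * w = 1 ∧ u * p + w * q = 1 ∧
      ∀ y : G, (φ y : Matrix (Fin m) (Fin m) ℂ) * u = u * (y : Matrix (Fin n) (Fin n) ℂ) ∧
        (φ y : Matrix (Fin m) (Fin m) ℂ) * w = 0 := by
  obtain ⟨l, r, z⟩ := t
  obtain rfl : l = 1 := hl
  obtain rfl : r = 0 := hr
  obtain ⟨e, he⟩ := hφ
  let iU : (Fin n → ℂ) →ₗ[ℂ] (Fin 1 → Fin n → ℂ) × (Fin 0 → Fin n → ℂ) × (Fin z → ℂ) :=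
    LinearMap.inl ℂ _ _ ∘ₗ LinearMap.pi fun _ => LinearMap.id
  let iW : (Fin z → ℂ) →ₗ[ℂ] (Fin 1 → Fin n → ℂ) × (Fin 0 → Fin n → ℂ) × (Fin z → ℂ) :=
    LinearMap.inr ℂ _ _ ∘ₗ LinearMap.inr ℂ _ _
  let pU : (Fin 1 → Fin n → ℂ) × (Fin 0 → Fin n → ℂ) × (Fin z → ℂ) →ₗ[ℂ] (Fin n → ℂ) :=
    LinearMap.proj 0 ∘ₗ LinearMap.fst ℂ _ _
  let pW : (Fin 1 → Fin n → ℂ) × (Fin 0 → Fin n → ℂ) × (Fin z → ℂ) →ₗ[ℂ] (Fin z → ℂ) :=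
    LinearMap.snd ℂ _ _ ∘ₗ LinearMap.snd ℂ _ _
  have hid : iU ∘ₗ pU + iW ∘ₗ pW = LinearMap.id := by
    refine LinearMap.ext fun x => ?_
    refine Prod.ext ?_ (Prod.ext (Subsingleton.elim _ _) ?_)
    · ext a b
      rw [Subsingleton.elim a 0]
      simp [iU, iW, pU, pW]
    · ext a
      simp [iU, iW, pU, pW]
  refine ⟨z, LinearMap.toMatrix' (e.symm.toLinearMap ∘ₗ iU),
    LinearMap.toMatrix' (e.symm.toLinearMap ∘ₗ iW), LinearMap.toMatrix' (pU ∘ₗ e.toLinearMap),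
    LinearMap.toMatrix' (pW ∘ₗ e.toLinearMap), ?_, ?_, ?_, ?_, ?_⟩
  · have := e.finrank_eq
    simpa [Module.finrank_pi_fintype] using this
  · rw [← LinearMap.toMatrix'_comp, ← LinearMap.toMatrix'_id]
    congr 1
    ext
    simp [pU, iU]
  · rw [← LinearMap.toMatrix'_comp, ← LinearMap.toMatrix'_id]
    congr 1
    ext
    simp [pW, iW]
  · rw [← LinearMap.toMatrix'_comp, ← LinearMap.toMatrix'_comp, ← map_add, ← LinearMap.toMatrix'_id]
    congr 1
    refine LinearMap.ext fun x => e.injective ?_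
    have := LinearMap.congr_fun hid (e x)
    simpa using this
  · intro y
    constructor
    · rw [← (LinearMap.toMatrix'.apply_symm_apply (φ y : Matrix (Fin m) (Fin m) ℂ)),
        ← (LinearMap.toMatrix'.apply_symm_apply (y : Matrix (Fin n) (Fin n) ℂ)),
        ← LinearMap.toMatrix'_comp, ← LinearMap.toMatrix'_comp]
      congr 1
      refine LinearMap.ext fun x => e.injective ?_
      have := he y (e.symm (iU x))
      refine Eq.trans this ?_
      refine Prod.ext ?_ (Prod.ext (Subsingleton.elim _ _) ?_)
      · ext a b
        simp [iU]
      · ext a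
        simp [iU]
    · rw [← (LinearMap.toMatrix'.apply_symm_apply (φ y : Matrix (Fin m) (Fin m) ℂ)),
        ← LinearMap.toMatrix'_comp, ← map_zero LinearMap.toMatrix']
      congr 1
      refine LinearMap.ext fun x => e.injective ?_
      have := he y (e.symm (iW x))
      refine Eq.trans this ?_
      refine Prod.ext ?_ (Prod.ext (Subsingleton.elim _ _) ?_)
      · ext a b
        simp [iW]
      · ext a
        simp

/-- The `(n + z) × z` matrix whose columns are the last `z` standard basis vectors. -/
def complMatrix (n z : ℕ) : Matrix (Fin (n + z)) (Fin z) ℂ :=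
  Matrix.of fun i j => if (i : ℕ) = n + j then 1 else 0

theorem inclMatrix_add_complMatrix (n z : ℕ) :
    inclMatrix (n + z) n * (inclMatrix (n + z) n).transpose +
      complMatrix n z * (complMatrix n z).transpose = 1 := by
  ext i j
  rw [Matrix.add_apply, Matrix.mul_apply, Matrix.mul_apply]
  refine Fin.addCases (fun a => ?_) (fun a => ?_) i
  · rw [Finset.sum_eq_single a, Finset.sum_eq_zero]
    · simp [inclMatrix, Matrix.one_apply, Fin.ext_iff, eq_comm]
    · intro b _
      have : (a : ℕ) ≠ n + b := by omega
      simp [complMatrix, this]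
    · intro b _ hb
      have : (a : ℕ) ≠ b := fun h => hb (Fin.ext h.symm)
      simp [inclMatrix, this]
    · simp
  · rw [Finset.sum_eq_zero, Finset.sum_eq_single a]
    · simp [complMatrix, Matrix.one_apply, Fin.ext_iff, eq_comm]
    · intro b _ hb
      have : (a : ℕ) ≠ b := fun h => hb (Fin.ext h.symm)
      simp [complMatrix, this]
    · simp
    · intro b _
      have : n + (a : ℕ) ≠ b := by omega
      simp [inclMatrix, this]

theorem complMatrix_transpose_mul_self (n z : ℕ) :
    (complMatrix n z).transpose * complMatrix n z = 1 := by
  ext i j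
  rw [Matrix.mul_apply, Finset.sum_eq_single (Fin.natAdd n i)]
  · simp [complMatrix, Matrix.one_apply, Fin.ext_iff]
  · intro b _ hb
    have : (b : ℕ) ≠ n + i := fun h => hb (Fin.ext h)
    simp [complMatrix, this]
  · simp

theorem complMatrix_transpose_mul_inclMatrix (n z : ℕ) :
    (complMatrix n z).transpose * inclMatrix (n + z) n = 0 := by
  ext i j
  rw [Matrix.mul_apply]
  refine Finset.sum_eq_zero fun b _ => ?_
  by_cases h : (b : ℕ) = n + i
  · have : (b : ℕ) ≠ j := by omega
    simp [inclMatrix, this]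
  · simp [complMatrix, h]

theorem formMatrix_mul_complMatrix {X : ClassicalType} {n z : ℕ} (hX : X = .C → Even n) :
    formMatrix X (n + z) * complMatrix n z = complMatrix n z * formMatrix X z := by
  cases X
  · simp [formMatrix]
  · ext i j
    rw [Matrix.mul_apply, Finset.sum_eq_single (Fin.natAdd n j), Matrix.mul_apply]
    · refine Fin.addCases (fun a => ?_) (fun a => ?_) i
      · rw [Finset.sum_eq_zero]
        · have h1 : altEntry a (n + j) = 0 := altEntry_eq_zero (by
            have := altPartner_lt (hX rfl) a.2
            omega)
          simp [formMatrix, h1]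
        · intro b _
          have : (a : ℕ) ≠ n + b := by omega
          simp [complMatrix, this]
      · rw [Finset.sum_eq_single a]
        · simp [formMatrix, complMatrix, altEntry, Nat.even_add, hX rfl, add_assoc]
        · intro b _ hb
          have : (a : ℕ) ≠ b := fun h => hb (Fin.ext h.symm)
          simp [complMatrix, this]
        · simp
    · intro b _ hb
      have : (b : ℕ) ≠ n + j := fun h => hb (Fin.ext h)
      simp [complMatrix, this]
    · simp
  · simp [formMatrix]

theorem inclMatrix_formMatrix_add (X : ClassicalType) (n z : ℕ) (hX : X = .C → Even n) :
    inclMatrix (n + z) n * formMatrix X n * (inclMatrix (n + z) n).transpose +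
      complMatrix n z * formMatrix X z * (complMatrix n z).transpose = formMatrix X (n + z) := by
  rw [← formMatrix_mul_inclMatrix (Nat.le_add_right n z) hX, ← formMatrix_mul_complMatrix hX,
    Matrix.mul_assoc, Matrix.mul_assoc, ← Matrix.mul_add, inclMatrix_add_complMatrix, Matrix.mul_one]

/-- An embedding of signature `(1, 0, z)` of a classical Lie algebra of type `C` or `O` has a
splitting adapted to the invariant forms. -/
theorem exists_adapted_splitting {X : ClassicalType} (hA : X ≠ .A) {n z : ℕ} (hn : minDim X ≤ n)
    (hCn : X = .C → Even n) (hCz : X = .C → Even z)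
    {φ : classical X n → classical X (n + z)}
    {u : Matrix (Fin (n + z)) (Fin n) ℂ} {w : Matrix (Fin (n + z)) (Fin z) ℂ}
    {p : Matrix (Fin n) (Fin (n + z)) ℂ} {q : Matrix (Fin z) (Fin (n + z)) ℂ}
    (hpu : p * u = 1) (hqw : q * w = 1) (hone : u * p + w * q = 1)
    (hu : ∀ y, (φ y : Matrix (Fin (n + z)) (Fin (n + z)) ℂ) * u =
      u * (y : Matrix (Fin n) (Fin n) ℂ))
    (hw : ∀ y, (φ y : Matrix (Fin (n + z)) (Fin (n + z)) ℂ) * w = 0) :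
    ∃ (c : ℂ) (d : Matrix (Fin z) (Fin z) ℂ),
      (c • u).transpose * formMatrix X (n + z) * (c • u) = formMatrix X n ∧
      (c • u).transpose * formMatrix X (n + z) * (w * d) = 0 ∧
      (w * d).transpose * formMatrix X (n + z) * (w * d) = formMatrix X z := by
  set J := formMatrix X (n + z) with hJ
  have hJJ : J * J.transpose = 1 := formMatrix_mul_transpose hA fun h => (hCn h).add (hCz h)
  have hJn := formMatrix_mul_transpose (n := n) hA hCn
  have hsJ : J.transpose = formSign X • J := formMatrix_transpose X _
  have hφJ : ∀ y, (φ y : Matrix (Fin (n + z)) (Fin (n + z)) ℂ).transpose * J = -(J * φ y) :=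
    fun y => (mem_classical_iff.1 (φ y).2).1
  have hyJ : ∀ y : classical X n, (y : Matrix (Fin n) (Fin n) ℂ).transpose * formMatrix X n =
      -(formMatrix X n * (y : Matrix (Fin n) (Fin n) ℂ)) := fun y => (mem_classical_iff.1 y.2).1
  have hskew : ∀ (y : classical X n) (k : ℕ) (x : Matrix (Fin (n + z)) (Fin k) ℂ),
      (y : Matrix (Fin n) (Fin n) ℂ).transpose * (u.transpose * J * x) =
        -(u.transpose * J * ((φ y : Matrix (Fin (n + z)) (Fin (n + z)) ℂ) * x)) := by
    intro y k x
    have h1 := congrArg Matrix.transpose (hu y)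
    rw [Matrix.transpose_mul, Matrix.transpose_mul] at h1
    rw [← Matrix.mul_assoc, ← Matrix.mul_assoc, ← h1, Matrix.mul_assoc u.transpose, hφJ]
    simp only [Matrix.mul_neg, Matrix.neg_mul, Matrix.mul_assoc]
  -- The form identifies the dual of the natural module with the natural module. Together with
  -- `hskew` this turns `uᵀ J x` into a map to the natural module.
  have hmove : ∀ (y : classical X n) (k : ℕ) (x : Matrix (Fin n) (Fin k) ℂ),
      (y : Matrix (Fin n) (Fin n) ℂ) * ((formMatrix X n).transpose * x) =
        -((formMatrix X n).transpose * ((y : Matrix (Fin n) (Fin n) ℂ).transpose * x)) := by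
    intro y k x
    have h1 : (y : Matrix (Fin n) (Fin n) ℂ) * (formMatrix X n).transpose =
        -((formMatrix X n).transpose * (y : Matrix (Fin n) (Fin n) ℂ).transpose) := by
      have h2 := congrArg (fun a => (formMatrix X n).transpose * a * (formMatrix X n).transpose)
        (hyJ y)
      simp only [Matrix.mul_assoc, Matrix.mul_neg, Matrix.neg_mul] at h2
      rw [hJn, Matrix.mul_one, ← Matrix.mul_assoc _ (formMatrix X n), mul_eq_one_comm.1 hJn,
        Matrix.one_mul] at h2
      rw [h2, neg_neg]
    rw [← Matrix.mul_assoc, h1, Matrix.neg_mul, Matrix.mul_assoc]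
  -- After that identification the columns are invariant vectors of the natural module, hence zero:
  -- the trivial part is orthogonal to the image of `u`.
  have huw : u.transpose * J * w = 0 := by
    have h1 : (formMatrix X n).transpose * (u.transpose * J * w) = 0 := by
      ext i j
      refine congrFun (eq_zero_of_forall_mulVec_eq_zero (v := fun i =>
        ((formMatrix X n).transpose * (u.transpose * J * w)) i j) hA hn hCn fun y hy => ?_) i
      have h2 := hmove ⟨y, hy⟩ z (u.transpose * J * w)
      rw [hskew, hw, Matrix.mul_zero, neg_zero, Matrix.mul_zero, neg_zero] at h2
      ext k
      exact congrFun (congrFun h2 k) j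
    have h2 := congrArg (formMatrix X n * ·) h1
    simpa only [← Matrix.mul_assoc, hJn, Matrix.one_mul, Matrix.mul_zero] using h2
  have hwu : w.transpose * J * u = 0 := by
    have h1 := congrArg Matrix.transpose huw
    rw [Matrix.transpose_mul, Matrix.transpose_mul, hsJ, Matrix.transpose_transpose,
      Matrix.transpose_zero, Matrix.smul_mul, Matrix.mul_smul, ← Matrix.mul_assoc] at h1
    have hne : formSign X ≠ 0 := by cases X <;> simp [formSign]
    exact (smul_eq_zero.1 h1).resolve_left hne
  -- The form pulled back along `u` is invariant, so by Schur's lemma it is a multiple of the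
  -- standard one.
  obtain ⟨a, ha⟩ := exists_eq_smul_one_of_commute hA hn hCn
    (M := (formMatrix X n).transpose * (u.transpose * J * u)) (fun y hy => by
      have h1 := hmove ⟨y, hy⟩ n (u.transpose * J * u)
      rw [hskew, hu] at h1
      rw [h1]
      simp only [Matrix.mul_neg, neg_neg, Matrix.mul_assoc])
  have huu : u.transpose * J * u = a • formMatrix X n := by
    have h2 := congrArg (formMatrix X n * ·) ha
    simpa only [← Matrix.mul_assoc, hJn, Matrix.one_mul, Matrix.mul_smul, Matrix.mul_one] using h2
  -- Otherwise the image of `u` is orthogonal to everything, contradicting that `J` is invertible.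
  have ha0 : a ≠ 0 := by
    rintro rfl
    rw [zero_smul] at huu
    have h1 : u.transpose * J = 0 := by
      rw [← Matrix.mul_one (u.transpose * J), ← hone, Matrix.mul_add, ← Matrix.mul_assoc,
        ← Matrix.mul_assoc, huu, huw, Matrix.zero_mul, Matrix.zero_mul, add_zero]
    have h2 : u.transpose = 0 := by
      rw [← Matrix.mul_one u.transpose, ← hJJ, ← Matrix.mul_assoc, h1, Matrix.zero_mul]
    have h3 : u = 0 := by rw [← Matrix.transpose_transpose u, h2, Matrix.transpose_zero]
    rw [h3, Matrix.mul_zero] at hpu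
    have h0 : 0 < n := lt_of_lt_of_le (by cases X <;> simp [minDim]) hn
    have := congrFun (congrFun hpu ⟨0, h0⟩) ⟨0, h0⟩
    simp at this
  have hS : (w.transpose * J * w) * (q * J.transpose * q.transpose) = 1 := by
    have h1 : w.transpose * J * w * q = w.transpose * J := by
      conv_rhs => rw [← Matrix.mul_one (w.transpose * J), ← hone, Matrix.mul_add,
        ← Matrix.mul_assoc, ← Matrix.mul_assoc, hwu, Matrix.zero_mul, zero_add]
    rw [← Matrix.mul_assoc, ← Matrix.mul_assoc, h1, Matrix.mul_assoc w.transpose, hJJ,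
      Matrix.mul_one, ← Matrix.transpose_mul, hqw, Matrix.transpose_one]
  have hsS : (w.transpose * J * w).transpose = formSign X • (w.transpose * J * w) := by
    rw [Matrix.transpose_mul, Matrix.transpose_mul, hsJ, Matrix.transpose_transpose,
      Matrix.smul_mul, Matrix.mul_smul, ← Matrix.mul_assoc]
  obtain ⟨d, hd⟩ := exists_transpose_mul_mul_eq hA hCz hS hsS
  -- Scaling `u` by a square root of `a⁻¹` normalises the form on its image, while `d` normalises it
  -- on the trivial part.
  obtain ⟨c, hc⟩ := IsAlgClosed.exists_eq_mul_self a⁻¹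
  refine ⟨c, d, ?_, ?_, ?_⟩
  · rw [Matrix.transpose_smul, Matrix.smul_mul, Matrix.smul_mul, Matrix.mul_smul, huu, smul_smul,
      smul_smul, ← hc, inv_mul_cancel₀ ha0, one_smul]
  · rw [Matrix.transpose_smul, Matrix.smul_mul, Matrix.smul_mul, ← Matrix.mul_assoc, huw,
      Matrix.zero_mul, smul_zero]
  · rw [← hd, Matrix.transpose_mul]
    simp only [Matrix.mul_assoc]

/-- Up to an isometry, an embedding of signature `(1, 0, z)` is the embedding as the upper left
block. -/
theorem HasSignature.exists_isometry {X : ClassicalType} {n m : ℕ} (hn : minDim X ≤ n)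
    (hCn : X = .C → Even n) (hCm : X = .C → Even m) {φ : classical X n →ₗ⁅ℂ⁆ classical X m}
    {t : Triple} (hφ : HasSignature φ t) (hl : t.l = 1) (hr : t.r = 0) :
    n ≤ m ∧ ∃ b b' : Matrix (Fin m) (Fin m) ℂ, b * b' = 1 ∧
      b.transpose * formMatrix X m * b = formMatrix X m ∧
      ∀ y : classical X n, (φ y : Matrix (Fin m) (Fin m) ℂ) * b =
        b * pad m (y : Matrix (Fin n) (Fin n) ℂ) := by
  obtain ⟨z, u, w, p, q, rfl, hpu, hqw, hone, hφ'⟩ := hφ.exists_splitting hl hr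
  refine ⟨Nat.le_add_right n z, ?_⟩
  set P := inclMatrix (n + z) n with hP
  set Q := complMatrix n z with hQ
  have hPP : P.transpose * P = 1 := inclMatrix_transpose_mul (Nat.le_add_right n z)
  have hQP : Q.transpose * P = 0 := complMatrix_transpose_mul_inclMatrix n z
  -- The intertwining property holds for every `c` and `d`, which leaves them free to be chosen so
  -- as to match the forms.
  have hcomm : ∀ (c : ℂ) (d : Matrix (Fin z) (Fin z) ℂ) (y : classical X n),
      (φ y : Matrix (Fin (n + z)) (Fin (n + z)) ℂ) *
        ((c • u) * P.transpose + (w * d) * Q.transpose) =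
      ((c • u) * P.transpose + (w * d) * Q.transpose) *
        pad (n + z) (y : Matrix (Fin n) (Fin n) ℂ) := by
    intro c d y
    have h1 : P.transpose * pad (n + z) (y : Matrix (Fin n) (Fin n) ℂ) =
        (y : Matrix (Fin n) (Fin n) ℂ) * P.transpose := by
      rw [pad, ← Matrix.mul_assoc, ← Matrix.mul_assoc, hPP, Matrix.one_mul]
    have h2 : Q.transpose * pad (n + z) (y : Matrix (Fin n) (Fin n) ℂ) = 0 := by
      rw [pad, ← Matrix.mul_assoc, ← Matrix.mul_assoc, hQP, Matrix.zero_mul, Matrix.zero_mul]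
    rw [Matrix.mul_add, Matrix.add_mul, Matrix.mul_assoc (c • u), h1, Matrix.mul_assoc (w * d), h2,
      Matrix.mul_zero, add_zero, ← Matrix.mul_assoc, Matrix.mul_smul, (hφ' y).1,
      ← Matrix.mul_assoc, ← Matrix.mul_assoc, (hφ' y).2, Matrix.zero_mul, Matrix.zero_mul, add_zero,
      Matrix.smul_mul, Matrix.smul_mul, Matrix.mul_assoc]
  by_cases hA : X = .A
  · subst hA
    refine ⟨(1 : ℂ) • u * P.transpose + w * 1 * Q.transpose, P * p + Q * q, ?_, ?_, hcomm 1 1⟩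
    · have hPQ' : P.transpose * Q = 0 := by
        rw [← Matrix.transpose_transpose Q, ← Matrix.transpose_mul, hQP, Matrix.transpose_zero]
      have hQQ : Q.transpose * Q = 1 := complMatrix_transpose_mul_self n z
      have h1 : P.transpose * (P * p + Q * q) = p := by
        rw [Matrix.mul_add, ← Matrix.mul_assoc, ← Matrix.mul_assoc, hPP, hPQ', Matrix.one_mul,
          Matrix.zero_mul, add_zero]
      have h2 : Q.transpose * (P * p + Q * q) = q := by
        rw [Matrix.mul_add, ← Matrix.mul_assoc, ← Matrix.mul_assoc, hQP, hQQ, Matrix.one_mul,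
          Matrix.zero_mul, zero_add]
      rw [Matrix.add_mul, Matrix.mul_assoc, Matrix.mul_assoc, h1, h2, one_smul, Matrix.mul_one, hone]
    · simp [formMatrix]
  · have hCz : X = .C → Even z := fun h => (Nat.even_add.1 (hCm h)).1 (hCn h)
    obtain ⟨c, d, h1, h2, h3⟩ := exists_adapted_splitting hA hn hCn hCz hpu hqw hone
      (fun y => (hφ' y).1) (fun y => (hφ' y).2)
    set J := formMatrix X (n + z) with hJ
    set b := (c • u) * P.transpose + (w * d) * Q.transpose with hb
    have h4 : (w * d).transpose * J * (c • u) = 0 := by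
      have h5 := congrArg Matrix.transpose h2
      rw [Matrix.transpose_mul, Matrix.transpose_mul (c • u).transpose, hJ, formMatrix_transpose,
        Matrix.transpose_transpose, Matrix.transpose_zero, Matrix.smul_mul (formSign X),
        Matrix.mul_smul _ (formSign X), ← Matrix.mul_assoc] at h5
      have hne : formSign X ≠ 0 := by cases X <;> simp [formSign]
      exact (smul_eq_zero.1 h5).resolve_left hne
    have hiso : b.transpose * J * b = J := by
      have h6 : b.transpose * J * b =
          P * ((c • u).transpose * J * (c • u)) * P.transpose +
          P * ((c • u).transpose * J * (w * d)) * Q.transpose +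
          (Q * ((w * d).transpose * J * (c • u)) * P.transpose +
          Q * ((w * d).transpose * J * (w * d)) * Q.transpose) := by
        rw [hb, Matrix.transpose_add, Matrix.transpose_mul, Matrix.transpose_mul,
          Matrix.transpose_transpose, Matrix.transpose_transpose, Matrix.add_mul, Matrix.add_mul,
          Matrix.mul_add, Matrix.mul_add]
        simp only [Matrix.mul_assoc]
      rw [h6, h1, h2, h3, h4, Matrix.mul_zero, Matrix.mul_zero, Matrix.zero_mul, Matrix.zero_mul,
        add_zero, zero_add, inclMatrix_formMatrix_add X n z hCn]
    -- The inverse comes from `bᵀ J b = J` and `Jᵀ J = 1`.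
    refine ⟨b, J.transpose * b.transpose * J, ?_, hiso, hcomm c d⟩
    rw [mul_eq_one_comm, Matrix.mul_assoc, Matrix.mul_assoc, ← Matrix.mul_assoc b.transpose, hiso]
    exact mul_eq_one_comm.1 (formMatrix_mul_transpose hA hCm)

/-! ### Finite blocks in `gl(∞)` -/

theorem end_ext {f g : Module.End ℂ V} (h : ∀ i j, entry f i j = entry g i j) : f = g := by
  refine Finsupp.lhom_ext' fun j => LinearMap.ext_ring ?_
  ext i
  exact h i j

theorem pad_apply {n m : ℕ} (M : Matrix (Fin n) (Fin n) ℂ) (i j : Fin m) :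
    pad m M i j = if h : (i : ℕ) < n ∧ (j : ℕ) < n then M ⟨i, h.1⟩ ⟨j, h.2⟩ else 0 := by
  have h1 : ∀ (k : ℕ) (A : Matrix (Fin n) (Fin k) ℂ) (j : Fin k), (inclMatrix m n * A) i j =
      if h : (i : ℕ) < n then A ⟨i, h⟩ j else 0 := by
    intro k A j
    rw [Matrix.mul_apply]
    split_ifs with h
    · rw [Finset.sum_eq_single ⟨i, h⟩]
      · simp [inclMatrix]
      · intro b _ hb
        have : (i : ℕ) ≠ b := fun h => hb (Fin.ext h.symm)
        simp [inclMatrix, this]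
      · simp
    · refine Finset.sum_eq_zero fun b _ => ?_
      have : (i : ℕ) ≠ b := by omega
      simp [inclMatrix, this]
  have h2 : ∀ (k : ℕ) (A : Matrix (Fin k) (Fin n) ℂ) (i : Fin k),
      (A * (inclMatrix m n).transpose) i j = if h : (j : ℕ) < n then A i ⟨j, h⟩ else 0 := by
    intro k A i
    rw [Matrix.mul_apply]
    split_ifs with h
    · rw [Finset.sum_eq_single ⟨j, h⟩]
      · simp [inclMatrix]
      · intro b _ hb
        have : (j : ℕ) ≠ b := fun h => hb (Fin.ext h.symm)
        simp [inclMatrix, this]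
      · simp
    · refine Finset.sum_eq_zero fun b _ => ?_
      have : (j : ℕ) ≠ b := by omega
      simp [inclMatrix, this]
  rw [pad, h2]
  by_cases hj : (j : ℕ) < n
  · rw [dif_pos hj, h1]
    by_cases hi : (i : ℕ) < n <;> simp [hi, hj]
  · simp [hj]

/-- The operator whose matrix has `M` as upper left block and is zero elsewhere. -/
noncomputable def blockEnd {n : ℕ} (M : Matrix (Fin n) (Fin n) ℂ) : Module.End ℂ V :=
  Finsupp.linearCombination ℂ fun j : ℕ =>
    if h : j < n then ∑ i : Fin n, Finsupp.single (i : ℕ) (M i ⟨j, h⟩) else 0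

theorem blockEnd_single {n : ℕ} (M : Matrix (Fin n) (Fin n) ℂ) (j : ℕ) :
    blockEnd M (Finsupp.single j 1) =
      if h : j < n then ∑ i : Fin n, Finsupp.single (i : ℕ) (M i ⟨j, h⟩) else 0 := by
  simp [blockEnd]

theorem entry_blockEnd {n : ℕ} (M : Matrix (Fin n) (Fin n) ℂ) (i j : ℕ) :
    entry (blockEnd M) i j = if h : i < n ∧ j < n then M ⟨i, h.1⟩ ⟨j, h.2⟩ else 0 := by
  rw [entry, blockEnd_single]
  by_cases hj : j < n
  · rw [dif_pos hj, Finsupp.finsetSum_apply]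
    by_cases hi : i < n
    · rw [dif_pos ⟨hi, hj⟩, Finset.sum_eq_single ⟨i, hi⟩]
      · simp
      · intro b _ hb
        exact Finsupp.single_eq_of_ne fun h => hb (Fin.ext h.symm)
      · simp
    · rw [dif_neg (fun h => hi h.1)]
      refine Finset.sum_eq_zero fun b _ => Finsupp.single_eq_of_ne (by omega)
  · simp [hj]

theorem supportedIn_blockEnd {n : ℕ} (M : Matrix (Fin n) (Fin n) ℂ) :
    SupportedIn (blockEnd M) n := by
  intro i j hij
  rw [entry_blockEnd, dif_neg (by omega)]

theorem SupportedIn.eq_blockEnd {f : Module.End ℂ V} {n : ℕ} (hf : SupportedIn f n) :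
    f = blockEnd (Matrix.of fun i j : Fin n => entry f i j) := by
  refine end_ext fun i j => ?_
  rw [entry_blockEnd]
  split_ifs with h
  · rfl
  · exact hf i j (by omega)

theorem blockEnd_injective {n : ℕ} :
    Function.Injective (blockEnd : Matrix (Fin n) (Fin n) ℂ → Module.End ℂ V) := by
  intro M N h
  ext i j
  have := congrArg (fun f => entry f i j) h
  simpa [entry_blockEnd] using this

theorem blockEnd_add {n : ℕ} (M N : Matrix (Fin n) (Fin n) ℂ) :
    blockEnd (M + N) = blockEnd M + blockEnd N := by
  refine end_ext fun i j => ?_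
  rw [entry_add]
  simp only [entry_blockEnd]
  split_ifs <;> simp

theorem blockEnd_smul {n : ℕ} (c : ℂ) (M : Matrix (Fin n) (Fin n) ℂ) :
    blockEnd (c • M) = c • blockEnd M := by
  refine end_ext fun i j => ?_
  have : entry (c • blockEnd M) i j = c * entry (blockEnd M) i j := by simp [entry]
  rw [this]
  simp only [entry_blockEnd]
  split_ifs <;> simp

theorem blockEnd_mul {n : ℕ} (M N : Matrix (Fin n) (Fin n) ℂ) :
    blockEnd (M * N) = blockEnd M * blockEnd N := by
  refine end_ext fun i j => ?_
  rw [entry_mul _ _ (supportedIn_blockEnd N), Finset.sum_range]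
  simp only [entry_blockEnd]
  by_cases hi : i < n <;> by_cases hj : j < n <;> simp [hi, hj, Matrix.mul_apply]

/-- The embedding of `n × n` matrices into `gl(∞)` as upper left blocks. -/
noncomputable def blockHom (n : ℕ) : Matrix (Fin n) (Fin n) ℂ →ₗ⁅ℂ⁆ Module.End ℂ V where
  toFun := blockEnd
  map_add' := blockEnd_add
  map_smul' := blockEnd_smul
  map_lie' := by
    intro M N
    change blockEnd (M * N - N * M) = blockEnd M * blockEnd N - blockEnd N * blockEnd M
    rw [← blockEnd_mul, ← blockEnd_mul]
    refine end_ext fun i j => ?_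
    rw [entry_sub]
    simp only [entry_blockEnd]
    split_ifs <;> simp

theorem blockHom_apply {n : ℕ} (M : Matrix (Fin n) (Fin n) ℂ) : blockHom n M = blockEnd M := rfl

theorem blockEnd_pad {n m : ℕ} (h : n ≤ m) (M : Matrix (Fin n) (Fin n) ℂ) :
    blockEnd (pad m M) = blockEnd M := by
  refine end_ext fun i j => ?_
  simp only [entry_blockEnd, pad_apply]
  by_cases h1 : i < n ∧ j < n
  · rw [dif_pos ⟨by omega, by omega⟩, dif_pos h1]
  · rw [dif_neg h1]
    split_ifs <;> rfl

theorem trInf_blockEnd {n : ℕ} (M : Matrix (Fin n) (Fin n) ℂ) : trInf (blockEnd M) = M.trace := by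
  rw [trInf_eq (supportedIn_blockEnd M), Finset.sum_range]
  simp [entry_blockEnd, Matrix.trace]

/-! ### The finitary Lie algebras -/

/-- The finitary Lie algebra of type `X`. -/
noncomputable def classicalInf : ClassicalType → LieSubalgebra ℂ (Module.End ℂ V)
  | .A => slInf
  | .C => spInf
  | .O => soInf

theorem classicalInf_le_glInf (X : ClassicalType) : classicalInf X ≤ glInf := by
  cases X
  · exact fun f hf => hf.1
  · exact inf_le_left
  · exact inf_le_left

theorem formEntry_eq_zero {X : ClassicalType} {n : ℕ} (hX : X = .C → Even n) {i j : ℕ}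
    (h : i < n ∧ n ≤ j ∨ j < n ∧ n ≤ i) : formEntry X i j = 0 := by
  cases X
  · rfl
  · refine altEntry_eq_zero fun hj => ?_
    rcases h with h | h
    · have := altPartner_lt (hX rfl) h.1
      omega
    · have := altPartner_lt (hX rfl) h.1
      rw [hj, altPartner_altPartner] at this
      omega
  · have : i ≠ j := by omega
    simp [formEntry, this]

/-- Skewness is tested on basis vectors. Off the block both sides vanish, because the form does not
pair the first `n` basis vectors with the others. -/
theorem blockEnd_mem_skewAdjoint_iff {X : ClassicalType} {n : ℕ} (hX : X = .C → Even n)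
    (M : Matrix (Fin n) (Fin n) ℂ) :
    blockEnd M ∈ skewAdjointLieSubalgebra (bilinOf (formEntry X)) ↔
      M.transpose * formMatrix X n = -(formMatrix X n * M) := by
  have hB : ∀ i j, bilinOf (formEntry X) (Finsupp.single i 1) (Finsupp.single j 1) =
      formEntry X i j := by simp [bilinOf]
  have hB' : ∀ (i : ℕ) (c : ℂ), Finsupp.single i c = c • (Finsupp.single i 1 : V) := by simp
  have hl : ∀ j k, bilinOf (formEntry X) (blockEnd M (Finsupp.single j 1)) (Finsupp.single k 1) =
      if h : j < n then ∑ i : Fin n, M i ⟨j, h⟩ * formEntry X i k else 0 := by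
    intro j k
    rw [blockEnd_single]
    split_ifs
    · rw [map_sum, LinearMap.sum_apply]
      refine Finset.sum_congr rfl fun i _ => ?_
      rw [hB', map_smul, LinearMap.smul_apply, hB, smul_eq_mul]
    · simp
  have hr : ∀ j k, bilinOf (formEntry X) (Finsupp.single j 1) (blockEnd M (Finsupp.single k 1)) =
      if h : k < n then ∑ i : Fin n, formEntry X j i * M i ⟨k, h⟩ else 0 := by
    intro j k
    rw [blockEnd_single]
    split_ifs
    · rw [map_sum]
      refine Finset.sum_congr rfl fun i _ => ?_
      rw [hB' _ (M _ _), map_smul, hB, smul_eq_mul, mul_comm]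
    · simp
  have hiff : blockEnd M ∈ skewAdjointLieSubalgebra (bilinOf (formEntry X)) ↔
      ∀ j k, bilinOf (formEntry X) (blockEnd M (Finsupp.single j 1)) (Finsupp.single k 1) =
        -bilinOf (formEntry X) (Finsupp.single j 1) (blockEnd M (Finsupp.single k 1)) := by
    refine (LinearMap.mem_skewAdjointSubmodule (B := bilinOf (formEntry X)) _).trans ?_
    constructor
    · intro h j k
      rw [h]
      simp
    · intro h
      have : (bilinOf (formEntry X)).compl₁₂ (blockEnd M) LinearMap.id =
          -(bilinOf (formEntry X)).compl₁₂ LinearMap.id (blockEnd M) := by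
        refine Finsupp.lhom_ext' fun j => LinearMap.ext_ring ?_
        refine Finsupp.lhom_ext' fun k => LinearMap.ext_ring ?_
        simpa using h j k
      intro x y
      have := LinearMap.congr_fun (LinearMap.congr_fun this x) y
      simpa using this
  rw [hiff]
  constructor
  · intro h
    ext j k
    have := h j k
    rw [hl, hr, dif_pos j.2, dif_pos k.2] at this
    simpa [Matrix.mul_apply, formMatrix_apply] using this
  · intro h j k
    rw [hl, hr]
    by_cases hj : j < n <;> by_cases hk : k < n
    · have := congrFun (congrFun h ⟨j, hj⟩) ⟨k, hk⟩
      simpa [Matrix.mul_apply, formMatrix_apply, hj, hk] using this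
    · rw [dif_pos hj, dif_neg hk, neg_zero]
      refine Finset.sum_eq_zero fun i _ => ?_
      rw [formEntry_eq_zero hX (Or.inl ⟨i.2, not_lt.1 hk⟩), mul_zero]
    · rw [dif_neg hj, dif_pos hk, eq_comm, neg_eq_zero]
      refine Finset.sum_eq_zero fun i _ => ?_
      rw [formEntry_eq_zero hX (Or.inr ⟨i.2, not_lt.1 hj⟩), zero_mul]
    · rw [dif_neg hj, dif_neg hk, neg_zero]

theorem blockEnd_mem_classicalInf_iff {X : ClassicalType} {n : ℕ} (hX : X = .C → Even n)
    (M : Matrix (Fin n) (Fin n) ℂ) :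
    blockEnd M ∈ classicalInf X ↔ M ∈ classical X n := by
  have hgl : blockEnd M ∈ glInf := ⟨n, supportedIn_blockEnd M⟩
  rw [mem_classical_iff]
  cases X
  · have : blockEnd M ∈ classicalInf .A ↔ blockEnd M ∈ glInf ∧ trInf (blockEnd M) = 0 := Iff.rfl
    rw [this, trInf_blockEnd]
    simp [formMatrix, hgl]
  · rw [← blockEnd_mem_skewAdjoint_iff hX]
    have : blockEnd M ∈ classicalInf .C ↔ blockEnd M ∈ glInf ∧
      blockEnd M ∈ skewAdjointLieSubalgebra (bilinOf (formEntry .C)) := Iff.rfl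
    rw [this]
    simp [hgl]
  · rw [← blockEnd_mem_skewAdjoint_iff hX]
    have : blockEnd M ∈ classicalInf .O ↔ blockEnd M ∈ glInf ∧
      blockEnd M ∈ skewAdjointLieSubalgebra (bilinOf (formEntry .O)) := Iff.rfl
    rw [this]
    simp [hgl]

theorem isFinitary_iff {L : Type*} [LieRing L] [LieAlgebra ℂ L] :
    IsFinitary L ↔ ∃ X, Nonempty (L ≃ₗ⁅ℂ⁆ classicalInf X) := by
  constructor
  · rintro (h | h | h)
    exacts [⟨.A, h⟩, ⟨.O, h⟩, ⟨.C, h⟩]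
  · rintro ⟨X, h⟩
    cases X
    exacts [Or.inl h, Or.inr (Or.inr h), Or.inr (Or.inl h)]

/-! ### Gluing homomorphisms along an exhaustion -/

theorem exists_glue {L A : Type*} [LieRing L] [LieAlgebra ℂ L] [LieRing A] [LieAlgebra ℂ A]
    (K : ℕ → LieSubalgebra ℂ L) (hK : ∀ i, K i ≤ K (i + 1)) (hex : ∀ x, ∃ i, x ∈ K i)
    (ψ : ∀ i, K i →ₗ⁅ℂ⁆ A) (hψ : ∀ i x (hx : x ∈ K i), ψ (i + 1) ⟨x, hK i hx⟩ = ψ i ⟨x, hx⟩) :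
    ∃ Ψ : L →ₗ⁅ℂ⁆ A, ∀ i x (hx : x ∈ K i), Ψ x = ψ i ⟨x, hx⟩ := by
  have hmono : Monotone K := monotone_nat_of_le_succ hK
  have hle : ∀ i j (hij : i ≤ j) x (hx : x ∈ K i), ψ j ⟨x, hmono hij hx⟩ = ψ i ⟨x, hx⟩ := by
    intro i j hij x hx
    induction j, hij using Nat.le_induction with
    | base => rfl
    | succ j hij ih => rw [hψ j x (hmono hij hx), ih]
  choose n hn using hex
  let F : L → A := fun x => ψ (n x) ⟨x, hn x⟩
  have hF : ∀ i x (hx : x ∈ K i), F x = ψ i ⟨x, hx⟩ := by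
    intro i x hx
    rcases le_total (n x) i with h | h
    · exact (hle _ _ h x (hn x)).symm
    · exact hle _ _ h x hx
  have hcommon : ∀ x y, ∃ i, x ∈ K i ∧ y ∈ K i := fun x y =>
    ⟨max (n x) (n y), hmono (le_max_left _ _) (hn x), hmono (le_max_right _ _) (hn y)⟩
  refine ⟨{ toFun := F, map_add' := ?_, map_smul' := ?_, map_lie' := ?_ }, hF⟩
  · intro x y
    obtain ⟨i, hx, hy⟩ := hcommon x y
    rw [hF i x hx, hF i y hy, hF i _ (add_mem hx hy), ← map_add]; rfl
  · intro c x
    rw [hF _ x (hn x), hF _ _ ((K (n x)).smul_mem c (hn x)), RingHom.id_apply, ← map_smul]; rfl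
  · intro x y
    obtain ⟨i, hx, hy⟩ := hcommon x y
    rw [hF i x hx, hF i y hy, hF i _ ((K i).lie_mem hx hy), ← LieHom.map_lie]; rfl

/-! ### Isometries -/

/-- `c` is invertible and preserves the form of type `X`. -/
def IsIsometry (X : ClassicalType) {n : ℕ} (c : Matrix (Fin n) (Fin n) ℂ) : Prop :=
  c * c⁻¹ = 1 ∧ c.transpose * formMatrix X n * c = formMatrix X n

namespace IsIsometry

variable {X : ClassicalType} {n : ℕ} {c : Matrix (Fin n) (Fin n) ℂ}

theorem of_mul_eq_one {c' : Matrix (Fin n) (Fin n) ℂ} (h : c * c' = 1)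
    (hc : c.transpose * formMatrix X n * c = formMatrix X n) : IsIsometry X c :=
  ⟨by rw [Matrix.inv_eq_right_inv h, h], hc⟩

theorem one : IsIsometry X (1 : Matrix (Fin n) (Fin n) ℂ) :=
  of_mul_eq_one (mul_one 1) (by simp)

theorem inv_mul (hc : IsIsometry X c) : c⁻¹ * c = 1 := mul_eq_one_comm.1 hc.1

theorem inv (hc : IsIsometry X c) : IsIsometry X c⁻¹ := by
  refine of_mul_eq_one hc.inv_mul ?_
  have h1 : c⁻¹.transpose * c.transpose = 1 := by
    rw [← Matrix.transpose_mul, hc.1, Matrix.transpose_one]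
  conv_lhs => rw [← hc.2]
  rw [← Matrix.mul_assoc, ← Matrix.mul_assoc, h1, Matrix.one_mul, Matrix.mul_assoc, hc.1,
    Matrix.mul_one]

theorem mul {d : Matrix (Fin n) (Fin n) ℂ} (hc : IsIsometry X c) (hd : IsIsometry X d) :
    IsIsometry X (c * d) := by
  refine of_mul_eq_one (c' := d⁻¹ * c⁻¹) ?_ ?_
  · rw [Matrix.mul_assoc, ← Matrix.mul_assoc d, hd.1, Matrix.one_mul, hc.1]
  · rw [Matrix.transpose_mul]
    conv_rhs => rw [← hd.2, ← hc.2]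
    simp only [Matrix.mul_assoc]

theorem conj_mem (hc : IsIsometry X c) {y : Matrix (Fin n) (Fin n) ℂ} (hy : y ∈ classical X n) :
    c⁻¹ * y * c ∈ classical X n := by
  rw [mem_classical_iff] at hy ⊢
  refine ⟨?_, fun hA => ?_⟩
  · have h1 : c⁻¹.transpose * formMatrix X n = formMatrix X n * c := by
      conv_lhs => rw [← hc.2]
      rw [← Matrix.mul_assoc, ← Matrix.mul_assoc, ← Matrix.transpose_mul, hc.1,
        Matrix.transpose_one, Matrix.one_mul]
    have h2 : formMatrix X n * c⁻¹ = c.transpose * formMatrix X n := by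
      conv_lhs => rw [← hc.2]
      rw [Matrix.mul_assoc, hc.1, Matrix.mul_one]
    rw [Matrix.transpose_mul, Matrix.transpose_mul, Matrix.mul_assoc, Matrix.mul_assoc, h1,
      ← Matrix.mul_assoc y.transpose, hy.1, ← Matrix.mul_assoc (formMatrix X n),
      ← Matrix.mul_assoc (formMatrix X n), h2]
    simp only [Matrix.mul_assoc, Matrix.neg_mul, Matrix.mul_neg]
  · rw [Matrix.mul_assoc, Matrix.trace_mul_comm, Matrix.mul_assoc, hc.1, Matrix.mul_one, hy.2 hA]

/-- An isometry extended by the identity. -/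
theorem extend {m : ℕ} (h : n ≤ m) (hX : X = .C → Even n) (hc : IsIsometry X c) :
    IsIsometry X (pad m c + (1 - pad m (1 : Matrix (Fin n) (Fin n) ℂ))) := by
  have hp : ∀ a b : Matrix (Fin n) (Fin n) ℂ,
      (pad m a + (1 - pad m (1 : Matrix (Fin n) (Fin n) ℂ))) *
        (pad m b + (1 - pad m (1 : Matrix (Fin n) (Fin n) ℂ))) =
      pad m (a * b) + (1 - pad m (1 : Matrix (Fin n) (Fin n) ℂ)) := by
    intro a b
    simp only [mul_add, add_mul, mul_sub, sub_mul, ← pad_mul h, mul_one, one_mul]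
    abel
  refine of_mul_eq_one (c' := pad m c⁻¹ + (1 - pad m (1 : Matrix (Fin n) (Fin n) ℂ))) ?_ ?_
  · rw [hp, hc.1]; abel
  · have hJ : ∀ a : Matrix (Fin n) (Fin n) ℂ,
        pad m a * formMatrix X m = pad m (a * formMatrix X n) := by
      intro a
      rw [pad, pad, Matrix.mul_assoc, inclMatrix_transpose_mul_formMatrix h hX]
      simp only [Matrix.mul_assoc]
    have hJ' : ∀ a : Matrix (Fin n) (Fin n) ℂ,
        formMatrix X m * pad m a = pad m (formMatrix X n * a) := by
      intro a
      rw [pad, pad, ← Matrix.mul_assoc, ← Matrix.mul_assoc, formMatrix_mul_inclMatrix h hX]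
      simp only [Matrix.mul_assoc]
    have h1 : formMatrix X m * (pad m c + (1 - pad m (1 : Matrix (Fin n) (Fin n) ℂ))) =
        pad m (formMatrix X n * c) + (formMatrix X m - pad m (formMatrix X n)) := by
      rw [Matrix.mul_add, Matrix.mul_sub, hJ', hJ', Matrix.mul_one, Matrix.mul_one]
    have h2 := hc.2
    rw [Matrix.mul_assoc] at h2
    rw [Matrix.transpose_add, Matrix.transpose_sub, Matrix.transpose_one, pad_transpose,
      pad_transpose, Matrix.transpose_one, Matrix.mul_assoc, h1]
    simp only [mul_add, add_mul, mul_sub, sub_mul, ← pad_mul h, one_mul, hJ, h2]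
    abel

end IsIsometry

/-! ### Diagonal Lie algebras with almost all signatures `(1, 0, z)` -/

namespace DiagonalExhaustion

variable {X : ClassicalType} {T : ℕ → Triple} {L : Type*} [LieRing L] [LieAlgebra ℂ L]
  (D : DiagonalExhaustion X T L)

theorem natRep_injective (i : ℕ) : Function.Injective (D.natRep i) := fun _ _ h =>
  (D.equiv i).injective (Subtype.ext h)

/-- The representation of `D.sub i` on `V` by upper left blocks, after a change of basis. -/
noncomputable def blockRep (i : ℕ) (c : Matrix (Fin (natDim T (i + 1))) (Fin (natDim T (i + 1))) ℂ)
    (hc : IsIsometry X c) : D.sub i →ₗ⁅ℂ⁆ Module.End ℂ V :=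
  (blockHom _).comp
    { toFun := fun x => c⁻¹ * D.natRep i x * c
      map_add' := fun _ _ => by rw [map_add, Matrix.mul_add, Matrix.add_mul]
      map_smul' := fun _ _ => by rw [map_smul, Matrix.mul_smul, Matrix.smul_mul]; rfl
      map_lie' := by
        intro _ _
        rw [LieHom.map_lie, Ring.lie_def, Ring.lie_def, Matrix.mul_sub, Matrix.sub_mul]
        have : ∀ a b, c⁻¹ * a * c * (c⁻¹ * b * c) = c⁻¹ * (a * b) * c := fun a b => by
          rw [Matrix.mul_assoc _ c, ← Matrix.mul_assoc c, ← Matrix.mul_assoc c, hc.1, Matrix.one_mul]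
          simp only [Matrix.mul_assoc]
        rw [this, this] }

theorem blockRep_apply (i : ℕ) {c : Matrix (Fin (natDim T (i + 1))) (Fin (natDim T (i + 1))) ℂ}
    (hc : IsIsometry X c) (x : D.sub i) :
    D.blockRep i c hc x = blockEnd (c⁻¹ * D.natRep i x * c) := rfl

/-- The new change of basis is `b (c ⊕ 1)`: `b` straightens the embedding to an upper left block,
and `c ⊕ 1` carries over the change of basis already made. The condition on `s` with `l > 0` forces
`l = 1` and `r = 0`. -/
theorem exists_isometry_succ (hT : IsTripleSeq X T) {i : ℕ} (hs : sSeq T (i + 1) = 1)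
    {c : Matrix (Fin (natDim T (i + 1))) (Fin (natDim T (i + 1))) ℂ} (hc : IsIsometry X c) :
    ∃ (d : Matrix (Fin (natDim T (i + 1 + 1))) (Fin (natDim T (i + 1 + 1))) ℂ)
      (hd : IsIsometry X d), ∀ x (hx : x ∈ D.sub i),
        D.blockRep (i + 1) d hd ⟨x, D.le_succ i hx⟩ = D.blockRep i c hc ⟨x, hx⟩ := by
  have hl := hT.l_pos (i + 1)
  unfold sSeq at hs
  have hCn : X = .C → Even (natDim T (i + 1)) := fun h => D.even_dim h i
  obtain ⟨hnm, b, b', hbb, hb, hφ⟩ := (D.signature i).exists_isometry (D.minDim_le i)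
    hCn (fun h => D.even_dim h (i + 1)) (by omega) (by omega)
  have hbi : IsIsometry X b := .of_mul_eq_one hbb hb
  have hci := hc.extend hnm hCn
  refine ⟨_, hbi.mul hci, fun x hx => ?_⟩
  rw [blockRep_apply, blockRep_apply, ← blockEnd_pad hnm]
  congr 1
  have h1 : D.natRep (i + 1) ⟨x, D.le_succ i hx⟩ * b = b * pad (natDim T (i + 1 + 1)) (D.natRep i ⟨x, hx⟩) := by
    have h := hφ (D.equiv i ⟨x, hx⟩)
    have h1 : (((D.equiv (i + 1)).toLieHom.comp (LieSubalgebra.inclusion (D.le_succ i))).comp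
        (D.equiv i).symm.toLieHom) (D.equiv i ⟨x, hx⟩) = D.equiv (i + 1) ⟨x, D.le_succ i hx⟩ := by
      change D.equiv (i + 1) (LieSubalgebra.inclusion (D.le_succ i)
        ((D.equiv i).symm (D.equiv i ⟨x, hx⟩))) = _
      rw [LieEquiv.symm_apply_apply]
      rfl
    rw [h1] at h
    exact h
  set y := D.natRep i ⟨x, hx⟩
  have h2 : pad (natDim T (i + 1 + 1)) y * (pad (natDim T (i + 1 + 1)) c + (1 - pad (natDim T (i + 1 + 1)) (1 : Matrix (Fin (natDim T (i + 1))) _ ℂ))) =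
      (pad (natDim T (i + 1 + 1)) c + (1 - pad (natDim T (i + 1 + 1)) (1 : Matrix (Fin (natDim T (i + 1))) _ ℂ))) *
        pad (natDim T (i + 1 + 1)) (c⁻¹ * y * c) := by
    rw [Matrix.mul_add, Matrix.add_mul, Matrix.mul_sub, Matrix.sub_mul, ← pad_mul hnm,
      ← pad_mul hnm, ← pad_mul hnm, ← pad_mul hnm, Matrix.mul_assoc c⁻¹, ← Matrix.mul_assoc c,
      hc.1]
    simp
  have h3 := (hbi.mul hci).inv_mul
  rw [Matrix.mul_assoc, ← Matrix.mul_assoc _ b, h1, Matrix.mul_assoc b, h2, ← Matrix.mul_assoc b,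
    ← Matrix.mul_assoc, h3, Matrix.one_mul]

theorem natDim_le_succ (hT : IsTripleSeq X T) (i : ℕ) : natDim T i ≤ natDim T (i + 1) := by
  have h := Nat.pos_of_ne_zero (sSeq_ne_zero hT i)
  rw [natDim]
  nlinarith

/-- If the dimensions were bounded, they would reach a maximum. From there on the subalgebras would
coincide by dimension, making `L` finite-dimensional. -/
theorem exists_le_natDim (D : DiagonalExhaustion X T L) (hT : IsTripleSeq X T)
    (hL : ¬ FiniteDimensional ℂ L) (N i : ℕ) : ∃ j, i ≤ j ∧ N ≤ natDim T (j + 1) := by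
  have hmono : Monotone (natDim T) := monotone_nat_of_le_succ (natDim_le_succ hT)
  by_contra! hlt
  apply hL
  have hbdd : ∀ j, natDim T (j + 1) ≤ N := fun j =>
    (hmono (by omega : j + 1 ≤ max i j + 1)).trans (hlt _ (le_max_left i j)).le
  obtain ⟨k, hk⟩ : ∃ k, ∀ j, natDim T (j + 1) ≤ natDim T (k + 1) := by
    have hfin : (Set.range fun j => natDim T (j + 1)).Finite :=
      (Set.finite_Iic N).subset (by rintro _ ⟨j, rfl⟩; exact hbdd j)
    obtain ⟨_, ⟨k, rfl⟩, hk⟩ := Set.exists_max_image _ id hfin (Set.range_nonempty _)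
    exact ⟨k, fun j => hk _ ⟨j, rfl⟩⟩
  have hdim : ∀ j, Module.finrank ℂ (D.sub j) =
      Module.finrank ℂ (classical X (natDim T (j + 1))) := fun j =>
    (D.equiv j).toLinearEquiv.finrank_eq
  have hsub : ∀ j, k ≤ j → D.sub k = D.sub j := by
    intro j hkj
    have h1 : natDim T (j + 1) = natDim T (k + 1) := le_antisymm (hk j) (hmono (by omega))
    have := D.finiteDimensional_sub j
    have h2 : (D.sub k).toSubmodule = (D.sub j).toSubmodule :=
      Submodule.eq_of_le_of_finrank_eq (D.sub_mono hkj) (by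
        change Module.finrank ℂ (D.sub k) = Module.finrank ℂ (D.sub j)
        rw [hdim, hdim, h1])
    exact LieSubalgebra.toSubmodule_injective h2
  have := D.finiteDimensional_sub k
  refine Module.Finite.of_surjective (D.sub k).toSubmodule.subtype fun x => ?_
  obtain ⟨j, hj⟩ := D.exhausts x
  have hx : x ∈ D.sub k := by
    rw [hsub _ (le_max_left k j)]
    exact D.sub_mono (le_max_right k j) hj
  exact ⟨⟨x, hx⟩, rfl⟩

/-- From `i₀` on, all inclusions can be straightened successively to block inclusions. The resulting
block representations agree on smaller terms and glue to an isomorphism onto `classicalInf X`. -/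
theorem isFinitary_of_sSeq_eq_one (D : DiagonalExhaustion X T L) (hT : IsTripleSeq X T) (hL : ¬ FiniteDimensional ℂ L) (i₀ : ℕ)
    (hs : ∀ i, i₀ ≤ i → sSeq T (i + 1) = 1) : IsFinitary L := by
  have hstep := fun (k : ℕ)
    (c : {c : Matrix (Fin (natDim T (i₀ + k + 1))) (Fin (natDim T (i₀ + k + 1))) ℂ //
      IsIsometry X c}) =>
    D.exists_isometry_succ hT (hs (i₀ + k) (Nat.le_add_right _ _)) c.2
  choose d hd hdc using hstep
  let c : ∀ k, {c : Matrix (Fin (natDim T (i₀ + k + 1))) (Fin (natDim T (i₀ + k + 1))) ℂ //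
      IsIsometry X c} := fun k => Nat.rec ⟨1, .one⟩ (fun k c => ⟨d k c, hd k c⟩) k
  obtain ⟨Ψ, hΨ⟩ := exists_glue (fun k => D.sub (i₀ + k)) (fun k => D.le_succ (i₀ + k))
    (fun x => by
      obtain ⟨j, hj⟩ := D.exhausts x
      exact ⟨j, D.sub_mono (Nat.le_add_left j i₀) hj⟩)
    (fun k => D.blockRep (i₀ + k) (c k).1 (c k).2) (fun k x hx => hdc k (c k) x hx)
  have hinj : Function.Injective Ψ := by
    rw [injective_iff_map_eq_zero]
    intro x hx
    obtain ⟨j, hj⟩ := D.exhausts x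
    have hx' : x ∈ D.sub (i₀ + j) := D.sub_mono (Nat.le_add_left j i₀) hj
    rw [hΨ j x hx', blockRep_apply, ← map_zero (blockHom (natDim T (i₀ + j + 1))),
      blockHom_apply] at hx
    have h1 := blockEnd_injective hx
    have hc := (c j).2
    have h2 : D.natRep (i₀ + j) ⟨x, hx'⟩ = 0 := by
      have h3 := congrArg (fun a => (c j).1 * a * (c j).1⁻¹) h1
      simp only [Matrix.mul_zero, Matrix.zero_mul] at h3
      rw [← h3, Matrix.mul_assoc, Matrix.mul_assoc, hc.1, Matrix.mul_one, ← Matrix.mul_assoc, hc.1,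
        Matrix.one_mul]
    have h3 := D.natRep_injective _ (h2.trans (map_zero _).symm)
    exact congrArg Subtype.val h3
  have hrange : (Ψ.range : Set (Module.End ℂ V)) = classicalInf X := by
    ext f
    constructor
    · rintro ⟨x, rfl⟩
      obtain ⟨j, hj⟩ := D.exhausts x
      have hx' : x ∈ D.sub (i₀ + j) := D.sub_mono (Nat.le_add_left j i₀) hj
      change Ψ x ∈ classicalInf X
      rw [hΨ j x hx', blockRep_apply,
        blockEnd_mem_classicalInf_iff (fun h => D.even_dim h (i₀ + j))]
      exact (c j).2.conj_mem (D.equiv (i₀ + j) ⟨x, hx'⟩).2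
    · intro hf
      obtain ⟨n, hn⟩ := classicalInf_le_glInf X hf
      -- Surjectivity is where infinite dimension enters: some block must be large enough to hold
      -- the support of `f`.
      obtain ⟨j, hij, hj⟩ := D.exists_le_natDim hT hL n i₀
      obtain ⟨k, rfl⟩ := Nat.exists_eq_add_of_le hij
      obtain ⟨M, rfl⟩ : ∃ M : Matrix (Fin (natDim T (i₀ + k + 1))) _ ℂ, f = blockEnd M :=
        ⟨_, (hn.mono hj).eq_blockEnd⟩
      have hM : M ∈ classical X (natDim T (i₀ + k + 1)) :=
        (blockEnd_mem_classicalInf_iff (fun h => D.even_dim h (i₀ + k)) M).1 hf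
      have hc := (c k).2
      have hM' := hc.inv.conj_mem hM
      set x := (D.equiv (i₀ + k)).symm ⟨_, hM'⟩ with hx
      refine ⟨x, ?_⟩
      change Ψ x = blockEnd M
      rw [hΨ k x x.2, blockRep_apply]
      congr 1
      have h1 : D.natRep (i₀ + k) x = (c k).1⁻¹⁻¹ * M * (c k).1⁻¹ := by
        rw [natRep_apply, hx, LieEquiv.apply_symm_apply]
      change (c k).1⁻¹ * D.natRep (i₀ + k) x * (c k).1 = M
      rw [h1, ← Matrix.mul_assoc, ← Matrix.mul_assoc, hc.inv.1, Matrix.one_mul, Matrix.mul_assoc,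
        hc.inv_mul, Matrix.mul_one]
  exact isFinitary_iff.2 ⟨X, ⟨(LieEquiv.ofInjective Ψ hinj).trans (LieEquiv.ofEq _ _ hrange)⟩⟩

/-- Each term of the exhaustion acts through a finite block, and the trace of `F(h)²` does not
depend on the size of the block. So one non-zero `N` is divisible by all partial products of `s`. -/
theorem exists_sSeq_eq_one_of_injective (D : DiagonalExhaustion X T L) (hT : IsTripleSeq X T) (F : L →ₗ⁅ℂ⁆ Module.End ℂ V)
    (hF : Function.Injective F) (hgl : ∀ x, F x ∈ glInf) :
    ∃ i₀, ∀ i, i₀ ≤ i → sSeq T (i + 1) = 1 := by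
  obtain ⟨h, hne, h0, hidx⟩ := D.exists_index hT
  have hex : ∀ i, ∃ n, ∀ x : D.sub i, SupportedIn (F x) n := by
    intro i
    have := D.finiteDimensional_sub i
    let b := Module.finBasis ℂ (D.sub i)
    choose n hn using fun k => hgl (b k)
    refine ⟨Finset.univ.sup n, fun x => ?_⟩
    have hx : F x = ∑ k, b.repr x k • F (b k) := by
      have h1 := congrArg ((F.comp (D.sub i).incl : D.sub i →ₗ⁅ℂ⁆ Module.End ℂ V) :
        D.sub i →ₗ[ℂ] Module.End ℂ V) (b.sum_repr x).symm
      rw [map_sum] at h1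
      simp only [map_smul] at h1
      exact h1
    intro a c hac
    have hent : entry (F x) a c = ∑ k, b.repr x k * entry (F (b k)) a c := by
      rw [hx]
      simp [entry, LinearMap.sum_apply, Finsupp.finsetSum_apply]
    rw [hent]
    refine Finset.sum_eq_zero fun k _ => ?_
    rw [(hn k).mono (Finset.le_sup (Finset.mem_univ k)) a c hac, mul_zero]
  have hrep : ∀ i, ∃ (n : ℕ) (φ : D.sub i →ₗ⁅ℂ⁆ Matrix (Fin n) (Fin n) ℂ),
      ∀ x : D.sub i, F x = blockEnd (φ x) := by
    intro i
    obtain ⟨n, hn⟩ := hex i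
    have key : ∀ x : D.sub i, F x = blockEnd (Matrix.of fun a c : Fin n => entry (F x) a c) :=
      fun x => (hn x).eq_blockEnd
    refine ⟨n, { toFun := fun x => Matrix.of fun a c : Fin n => entry (F x) a c,
                 map_add' := ?_, map_smul' := ?_, map_lie' := ?_ }, key⟩
    · intro x y
      apply blockEnd_injective
      rw [← key, blockEnd_add, ← key, ← key]
      exact map_add F _ _
    · intro a x
      apply blockEnd_injective
      rw [← key, blockEnd_smul, ← key]
      exact map_smul F _ _
    · intro x y
      apply blockEnd_injective
      change _ = blockHom n _
      rw [← key, LieHom.map_lie, blockHom_apply, blockHom_apply, ← key, ← key]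
      exact LieHom.map_lie F _ _
  choose n φ hφ using hrep
  have htr : ∀ i, (φ i ⟨h, D.sub_mono (Nat.zero_le i) h0⟩ *
      φ i ⟨h, D.sub_mono (Nat.zero_le i) h0⟩).trace = trInf (F h * F h) := by
    intro i
    rw [← trInf_blockEnd, blockEnd_mul, ← hφ]
  obtain ⟨N, hN, hN0⟩ := hidx 0 _ (φ 0)
  have hN0' : N ≠ 0 := by
    refine hN0 fun hz => hne (hF ?_)
    have h1 := hφ 0 ⟨h, h0⟩
    rw [hz, ← blockHom_apply, map_zero] at h1
    rw [map_zero]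
    exact h1
  have hdvd : ∀ i, (∏ k ∈ Finset.range i, sSeq T (k + 1)) ∣ N := by
    intro i
    obtain ⟨M, hM, -⟩ := hidx i _ (φ i)
    rw [htr] at hM hN
    rw [hM, Finset.range_zero, Finset.prod_empty, mul_one, Nat.cast_inj] at hN
    exact Dvd.intro_left M hN
  have hpos : ∀ i, 0 < sSeq T (i + 1) := fun i => Nat.pos_of_ne_zero (sSeq_ne_zero hT _)
  have hfin : (Set.range fun i => ∏ k ∈ Finset.range i, sSeq T (k + 1)).Finite :=
    (Set.finite_Iic N).subset (by
      rintro _ ⟨i, rfl⟩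
      exact Nat.le_of_dvd (Nat.pos_of_ne_zero hN0') (hdvd i))
  -- The partial products are non-decreasing and bounded by `N`. Past an index where they are
  -- largest, every new factor is `1`.
  obtain ⟨_, ⟨i₀, rfl⟩, hi₀⟩ := Set.exists_max_image _ id hfin (Set.range_nonempty _)
  refine ⟨i₀, fun i hi => ?_⟩
  have h1 : ∏ k ∈ Finset.range (i + 1), sSeq T (k + 1) ≤ ∏ k ∈ Finset.range i₀, sSeq T (k + 1) :=
    hi₀ _ ⟨i + 1, rfl⟩
  have h2 : ∏ k ∈ Finset.range i₀, sSeq T (k + 1) ≤ ∏ k ∈ Finset.range i, sSeq T (k + 1) :=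
    Finset.prod_le_prod_of_subset_of_one_le' (Finset.range_mono hi) fun k _ _ => hpos k
  have h3 : 0 < ∏ k ∈ Finset.range i, sSeq T (k + 1) := Finset.prod_pos fun k _ => hpos k
  rw [Finset.prod_range_succ] at h1
  have h4 := hpos i
  nlinarith

theorem isFinitary_of_injective (D : DiagonalExhaustion X T L) (hT : IsTripleSeq X T)
    (hL : ¬ FiniteDimensional ℂ L) {L' : Type*} [LieRing L'] [LieAlgebra ℂ L'] (hL' : IsFinitary L')
    (f : L →ₗ⁅ℂ⁆ L') (hf : Function.Injective f) : IsFinitary L := by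
  obtain ⟨Y, ⟨E⟩⟩ := isFinitary_iff.1 hL'
  obtain ⟨i₀, hi₀⟩ := D.exists_sSeq_eq_one_of_injective hT
    ((classicalInf Y).incl.comp (E.toLieHom.comp f))
    (Subtype.val_injective.comp (E.injective.comp hf))
    (fun x => classicalInf_le_glInf Y (E (f x)).2)
  exact D.isFinitary_of_sSeq_eq_one hT hL i₀ hi₀

end DiagonalExhaustion

end DiagonalLie

open DiagonalLie in
theorem mainTheorem10 (X₁ X₂ : ClassicalType) (T₁ T₂ : ℕ → Triple)
    (L₁ L₂ : Type*) [LieRing L₁] [LieAlgebra ℂ L₁] [LieRing L₂] [LieAlgebra ℂ L₂]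
    (h₁ : IsDiagonalLieAlgebra X₁ T₁ L₁) (h₂ : IsDiagonalLieAlgebra X₂ T₂ L₂) :
    (∀ f : L₁ →ₗ⁅ℂ⁆ L₂, Function.Injective f →
      ∃ N : ℕ, 0 < N ∧
        (Stz (sSeq T₁)).Divides ((SteinitzNumber.ofPosNat N).mul (Stz (sSeq T₂)))) ∧
    (¬ IsFinitary L₁ → IsFinitary L₂ → ¬ ∃ f : L₁ →ₗ⁅ℂ⁆ L₂, Function.Injective f) := by
  obtain ⟨hT₁, ⟨D₁⟩, hL₁⟩ := h₁
  obtain ⟨hT₂, ⟨D₂⟩, -⟩ := h₂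
  refine ⟨fun f hf => stz_divides_of_injective hT₁ hT₂ D₁ D₂ f hf, ?_⟩
  rintro hnot hfin ⟨f, hf⟩
  exact hnot (D₁.isFinitary_of_injective hT₁ hL₁ hfin f hf)
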